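/- Here $\mathbb N=\{1,2,\dots\}$, and an infinite set $M=(m_i)\subset\mathbb N$ is identified with its increasing enumeration. **Notation.** $S_0$ consists of $\emptyset$ and the singletons; $S_{\xi+1}$ consists of $\emptyset$ and the sets $\bigcup_{i=1}^k F_i$ with $k\le \min F_1$, $F_1<\dots<F_k$ nonempty, $F_i\in S_\xi$. A family of nonempty finite sets $E_1<\dots<E_k$ is $S_\xi$-admissible if $\{\min E_i:i\le k\}\in S_\xi$. A block basis of a sequence $(e_i)$ is a sequence of nonzero vectors $u_n=\sum_{i\in F_n}a_ie_i$ with $F_1<F_2<\cdots$ finite. A normalized sequence $(x_n)$ is an $\varepsilon$-$\ell_1^\xi$ spreading model ($\varepsilon>0$) if $\|\sum_{i\in F}a_ix_i\|\ge\varepsilon\sum_{i\in F}|a_i|$ for all $F\in S_\xi$ and all scalars $a_i$. A space with basis $(e_i)$ is asymptotic $\varepsilon$-$\ell_1^\xi$ ($\xi\ge1$) if every normalized block basis of $(e_i)$ is an $\varepsilon$-$\ell_1^\xi$ spreading model. For the block subspace $U$ generated by a block basis $(u_n)$, $\tau(U,\delta)$ is the supremum of the $\zeta<\omega$ such that every normalized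 block basis of $(u_n)$ has a subsequence which is a $\delta$-$\ell_1^\zeta$ spreading model. Let $N=(n_i)$, $P=(p_i)$ be infinite subsets of $\mathbb N$ with $p_i<n_i/2$ for all $i$ and $n_{i-1}\le p_i$ for $i\ge2$, let $\mathbf a=(\delta_i)$ decrease strictly to $0$, and let $d>1$. A space $X$ with Schauder basis $(e_i)$ satisfies the $(d,N,P,\mathbf a)$ distortion property if for every $j$, $X$ is asymptotic $\delta_j$-$\ell_1^{n_j}$ and $\tau(U,d\delta_j)<p_j$ for every block subspace $U$. A Banach space $X$ is arbitrarily distortable if for every $\lambda>1$ there is an equivalent norm $|\cdot|$ such that every closed infinite-dimensional subspace $Y$ contains nonzero $x,y$ with $\|x\|=\|y\|$ and $|x|/|y|>\lambda$. For a set $\mathcal M$ of finitely supported signed measures on $\mathbb N$ which (i) contains all point masses $e_n^*$, (ii) is symmetric, (iii) satisfies $\mu(\{n\})\le1$ for all $\mu\in\mathcal M$ and $n\in\mathbb N$, and (iv) is closed under restriction to initial segments $\{1,\dots,n\}$, let $X_{\mathcal M}$ be the completion of $c_{00}$ under $\|\sum a_ie_i\|_{\mathcal M}=\sup\{\sum a_i\mu(\{i\}):\mu\in\mathcal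 M\}$. The mixed Tsirelson space $T(1/m_i,S_{n_i})_{i=1}^\infty$ is the completion of $c_{00}$ under the norm determined by $$\|x\|=\max\Big\{\|x\|_\infty,\ \sup_j\sup\Big\{\tfrac1{m_j}\sum_{i=1}^k\|E_ix\|:\ E_1<\dots<E_k\ S_{n_j}\text{-admissible}\Big\}\Big\}\qquad(x\in c_{00}).$$ **Setting.** Let $M=(m_i)$ and $L=(l_i)$ be infinite subsets of $\mathbb N$ with $m_1>6$, $m_i^2<m_{i+1}$, $l_1>4$ and $2^{l_i}>m_i$ for all $i$. For an infinite $N=(n_i)\subset\mathbb N$ put $f_1^N=1$ and, for $j\ge2$, $$f_j^N=\max\Big\{\sum_{i<j}\rho_in_i:\ \rho_i\in\mathbb N\cup\{0\},\ \prod_{i<j}m_i^{\rho_i}<m_j^3\Big\}.$$ $N$ is called $M$-good if $l_j(f_j^N+1)<n_j$ for all $j$. **Theorem.** Suppose $N$ is $M$-good. There is exactly one seminorm on $c_{00}$ (necessarily a norm) satisfying the displayed equation, so that $T(1/m_i,S_{n_i})_{i=1}^\infty$ is well defined. There is a set $\mathcal M$ of finitely supported signed measures on $\mathbb N$ satisfying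 (i)–(iv) such that: 1. $X_{\mathcal M}$ is isometric to $T(1/m_i,S_{n_i})_{i=1}^\infty$, by a linear isometry mapping $e_i$ to $e_i$ for every $i$; 2. $(e_i)$ is a $1$-unconditional, shrinking, bimonotone Schauder basis of $X_{\mathcal M}$; 3. $X_{\mathcal M}$, with the basis $(e_i)$, satisfies the $(6,N,P,\mathbf a)$ distortion property with $P=(f_i^N+2)$ and $\mathbf a=(1/m_i)$; 4. $X_{\mathcal M}$ is arbitrarily distortable. -/

import Mathlib

open Filter Topology

noncomputable section

/-! Throughout, `ℕ+` is the set of natural numbers `1, 2, …`, an infinite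
subset `M = (m_i)` is given by its strictly increasing enumeration `m : ℕ+ → ℕ`, and `c_00` is
`ℕ+ →₀ ℝ`.  A finitely supported signed measure `μ` on `ℕ+` is also an element of `ℕ+ →₀ ℝ`,
namely its density `i ↦ μ({i})`. -/

/-- `E < F` for finite sets: every element of `E` is smaller than every element of `F`. -/
def FinsetLT (E F : Finset ℕ+) : Prop := ∀ a ∈ E, ∀ b ∈ F, a < b

/-- The Schreier families `S_ξ`, `ξ < ω`. -/
def schreier : ℕ → Set (Finset ℕ+)
  | 0 => {F | F = ∅ ∨ ∃ i, F = {i}}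
  | ξ + 1 => {F | F = ∅ ∨ ∃ (k : ℕ) (E : Fin k → Finset ℕ+),
      (∀ i, (E i).Nonempty ∧ E i ∈ schreier ξ) ∧
      (∀ i j, i < j → FinsetLT (E i) (E j)) ∧
      (∀ i, ∀ p ∈ E i, k ≤ (p : ℕ)) ∧
      F = Finset.univ.biUnion E}

/-- `E_1 < ⋯ < E_k` are nonempty, successive, and `{min E_i : i ≤ k} ∈ S_ξ`. -/
def IsAdmissible (ξ : ℕ) {k : ℕ} (E : Fin k → Finset ℕ+) : Prop :=
  (∀ i j, i < j → FinsetLT (E i) (E j)) ∧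
  ∃ t : Fin k → ℕ+, (∀ i, IsLeast (E i : Set ℕ+) (t i)) ∧ Finset.univ.image t ∈ schreier ξ

/-! ### Sequences in normed spaces -/

section Sequences

variable {X : Type*} [NormedAddCommGroup X] [NormedSpace ℝ X]

/-- `(e_i)` is a Schauder basis of `X`. -/
def IsSchauderBasis (e : ℕ+ → X) : Prop :=
  ∃ b : GeneralSchauderBasis ℕ+ ℝ X (SummationFilter.conditional ℕ+), b.basis = e

/-- `1`-unconditional: changing signs of coefficients does not increase the norm. -/
def IsOneUnconditional (e : ℕ+ → X) : Prop :=
  ∀ (F : Finset ℕ+) (a ε : ℕ+ → ℝ), (∀ i, ε i = 1 ∨ ε i = -1) →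
    ‖∑ i ∈ F, (ε i * a i) • e i‖ ≤ ‖∑ i ∈ F, a i • e i‖

/-- Bimonotone: the projections onto intervals have norm at most `1`. -/
def IsBimonotone (e : ℕ+ → X) : Prop :=
  ∀ (N k l : ℕ+) (a : ℕ+ → ℝ), l ≤ N →
    ‖∑ i ∈ Finset.Icc k l, a i • e i‖ ≤ ‖∑ i ∈ Finset.Icc 1 N, a i • e i‖

/-- Shrinking: `‖φ | [e_i : i ≥ k]‖ → 0` for every bounded functional `φ`. -/
def IsShrinking (e : ℕ+ → X) : Prop :=
  ∀ φ : X →L[ℝ] ℝ, Tendsto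
    (fun k : ℕ+ => ‖φ.comp (Submodule.span ℝ (e '' Set.Ici k)).topologicalClosure.subtypeL‖)
    atTop (𝓝 0)

/-- `(u_n)` is a block basis of `(e_i)`: nonzero finite combinations of the `e_i` over
successive finite sets. -/
def IsBlockBasis (e u : ℕ+ → X) : Prop :=
  ∃ (F : ℕ+ → Finset ℕ+) (a : ℕ+ → ℝ), (∀ i j, i < j → FinsetLT (F i) (F j)) ∧
    ∀ n, u n = ∑ i ∈ F n, a i • e i ∧ u n ≠ 0

/-- `(x_n)` is normalized. -/
def IsNormalizedSeq (x : ℕ+ → X) : Prop := ∀ n, ‖x n‖ = 1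

/-- The normalized sequence `(x_n)` is an `ε`-`ℓ₁^ξ` spreading model. -/
def IsL1SpreadingModel (ε : ℝ) (ξ : ℕ) (x : ℕ+ → X) : Prop :=
  0 < ε ∧ IsNormalizedSeq x ∧ ∀ F ∈ schreier ξ, ∀ a : ℕ+ → ℝ,
    ε * ∑ i ∈ F, |a i| ≤ ‖∑ i ∈ F, a i • x i‖

/-- The space with basis `(e_i)` is asymptotic `ε`-`ℓ₁^ξ`. -/
def IsAsymptoticL1 (e : ℕ+ → X) (ε : ℝ) (ξ : ℕ) : Prop :=
  0 < ε ∧ 1 ≤ ξ ∧ ∀ u : ℕ+ → X, IsBlockBasis e u → IsNormalizedSeq u → IsL1SpreadingModel ε ξ u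

/-- The modulus `τ(U, δ)`, where `U` is the space generated by the basic sequence `(u_n)`
with respect to which block bases are taken. -/
def tau (u : ℕ+ → X) (δ : ℝ) : ℕ∞ :=
  sSup {t : ℕ∞ | ∃ ζ : ℕ, t = ζ ∧ ∀ v : ℕ+ → X, IsBlockBasis u v → IsNormalizedSeq v →
    ∃ k : ℕ+ → ℕ+, StrictMono k ∧ IsL1SpreadingModel δ ζ (v ∘ k)}

/-- The space `X` with basis `(e_i)` satisfies the `(d, N, P, a)` distortion property, where
`N = (n_i)`, `P = (p_i)`, `a = (δ_i)`. -/
structure HasDistortionProperty (e : ℕ+ → X) (d : ℝ) (n p : ℕ+ → ℕ) (δ : ℕ+ → ℝ) : Prop where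
  basis : IsSchauderBasis e
  one_lt : 1 < d
  strictMono_n : StrictMono n
  n_pos : ∀ i, 0 < n i
  strictMono_p : StrictMono p
  p_pos : ∀ i, 0 < p i
  n_le_p : ∀ i, n i ≤ p (i + 1)
  p_lt_n : ∀ i, (p i : ℝ) < n i / 2
  decreasing : StrictAnti δ
  null : Tendsto δ atTop (𝓝 0)
  asymptotic : ∀ j, IsAsymptoticL1 e (δ j) (n j)
  tau_lt : ∀ j, ∀ u : ℕ+ → X, IsBlockBasis e u → tau u (d * δ j) < p j

/-- `X` is arbitrarily distortable. -/
def ArbitrarilyDistortable (X : Type*) [NormedAddCommGroup X] [NormedSpace ℝ X] : Prop :=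
  ∀ lam : ℝ, 1 < lam → ∃ q : Seminorm ℝ X,
    (∃ c C : ℝ, 0 < c ∧ 0 < C ∧ ∀ x, c * ‖x‖ ≤ q x ∧ q x ≤ C * ‖x‖) ∧
    ∀ Y : Submodule ℝ X, IsClosed (Y : Set X) → ¬ FiniteDimensional ℝ Y →
      ∃ x ∈ Y, ∃ y ∈ Y, x ≠ 0 ∧ y ≠ 0 ∧ ‖x‖ = ‖y‖ ∧ lam < q x / q y

end Sequences

/-! ### Completions of `c_00` -/

/-- `c_00` equipped with the (semi)norm `q`. -/
def C00 (_q : Seminorm ℝ (ℕ+ →₀ ℝ)) : Type := ℕ+ →₀ ℝ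

instance C00.instSeminormedAddCommGroup (q : Seminorm ℝ (ℕ+ →₀ ℝ)) :
    SeminormedAddCommGroup (C00 q) :=
  AddGroupSeminorm.toSeminormedAddCommGroup (E := ℕ+ →₀ ℝ) q.toAddGroupSeminorm

instance C00.instModule (q : Seminorm ℝ (ℕ+ →₀ ℝ)) : Module ℝ (C00 q) :=
  (Finsupp.module ℕ+ ℝ : Module ℝ (ℕ+ →₀ ℝ))

instance C00.instNormedSpace (q : Seminorm ℝ (ℕ+ →₀ ℝ)) : NormedSpace ℝ (C00 q) where
  norm_smul_le a x := (map_smul_eq_mul q a (show ℕ+ →₀ ℝ from x)).le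

/-- The completion of `(c_00, q)`. -/
abbrev CompletedC00 (q : Seminorm ℝ (ℕ+ →₀ ℝ)) : Type := UniformSpace.Completion (C00 q)

/-- The element `x` of `c_00`, viewed in `(c_00, q)`. -/
def C00.mk (q : Seminorm ℝ (ℕ+ →₀ ℝ)) (x : ℕ+ →₀ ℝ) : C00 q := x

/-- The unit vector `e_i` in the completion of `(c_00, q)`. -/
def unitVec (q : Seminorm ℝ (ℕ+ →₀ ℝ)) (i : ℕ+) : CompletedC00 q :=
  ((C00.mk q (Finsupp.single i 1) : C00 q) : UniformSpace.Completion (C00 q))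

/-! ### The space `X_𝓜` -/

/-- Sets `𝓜` of finitely supported signed measures that contain the point masses, are
symmetric, pointwise bounded, and closed under restriction to initial segments. -/
structure NormingSet where
  carrier : Set (ℕ+ →₀ ℝ)
  single_mem : ∀ i, Finsupp.single i 1 ∈ carrier
  neg_mem : ∀ μ ∈ carrier, -μ ∈ carrier
  le_one : ∀ μ ∈ carrier, ∀ i, μ i ≤ 1
  restrict_mem : ∀ μ ∈ carrier, ∀ k : ℕ+, μ.filter (fun i => i ≤ k) ∈ carrier

namespace NormingSet

/-- `∑ a_i μ({i})`. -/
def pairing (x μ : ℕ+ →₀ ℝ) : ℝ := x.sum fun i a => a * μ i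

theorem pairing_add (x y μ : ℕ+ →₀ ℝ) : pairing (x + y) μ = pairing x μ + pairing y μ :=
  Finsupp.sum_add_index' (by simp) (by intros; ring)

theorem pairing_smul (r : ℝ) (x μ : ℕ+ →₀ ℝ) : pairing (r • x) μ = r * pairing x μ := by
  unfold pairing
  rw [Finsupp.sum_smul_index (by simp), Finsupp.sum, Finsupp.sum, Finset.mul_sum]
  exact Finset.sum_congr rfl fun i _ => by ring

theorem pairing_neg (x μ : ℕ+ →₀ ℝ) : pairing x (-μ) = -pairing x μ := by
  simp [pairing, Finsupp.sum]

variable (𝓜 : NormingSet)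

/-- The set of values `∑ a_i μ({i})`, `μ ∈ 𝓜`. -/
def values (x : ℕ+ →₀ ℝ) : Set ℝ := (fun μ => pairing x μ) '' 𝓜.carrier

theorem values_nonempty (x : ℕ+ →₀ ℝ) : (𝓜.values x).Nonempty :=
  ⟨_, _, 𝓜.single_mem 1, rfl⟩

theorem values_bddAbove (x : ℕ+ →₀ ℝ) : BddAbove (𝓜.values x) := by
  refine ⟨∑ i ∈ x.support, |x i|, ?_⟩
  rintro _ ⟨μ, hμ, rfl⟩
  refine Finset.sum_le_sum fun i _ => ?_
  have h1 := 𝓜.le_one μ hμ i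
  have h2 := 𝓜.le_one _ (𝓜.neg_mem μ hμ) i
  rw [Finsupp.neg_apply] at h2
  have h3 : |μ i| ≤ 1 := abs_le.2 ⟨by linarith, h1⟩
  calc x i * μ i ≤ |x i * μ i| := le_abs_self _
    _ = |x i| * |μ i| := abs_mul _ _
    _ ≤ |x i| * 1 := by gcongr
    _ = |x i| := mul_one _

/-- The norm `‖∑ a_i e_i‖_𝓜 = sup {∑ a_i μ({i}) : μ ∈ 𝓜}` on `c_00`. -/
def norm : Seminorm ℝ (ℕ+ →₀ ℝ) :=
  Seminorm.ofSMulLE (fun x => sSup (𝓜.values x))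
    (by
      have : 𝓜.values 0 = {0} := by
        refine Set.eq_singleton_iff_nonempty_unique_mem.2 ⟨𝓜.values_nonempty 0, ?_⟩
        rintro _ ⟨μ, _, rfl⟩
        simp [pairing]
      rw [this, csSup_singleton])
    (by
      intro x y
      refine csSup_le (𝓜.values_nonempty _) ?_
      rintro _ ⟨μ, hμ, rfl⟩
      change pairing (x + y) μ ≤ _
      rw [pairing_add]
      exact add_le_add (le_csSup (𝓜.values_bddAbove x) ⟨μ, hμ, rfl⟩)
        (le_csSup (𝓜.values_bddAbove y) ⟨μ, hμ, rfl⟩))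
    (by
      intro r x
      refine csSup_le (𝓜.values_nonempty _) ?_
      rintro _ ⟨μ, hμ, rfl⟩
      change pairing (r • x) μ ≤ _
      rw [pairing_smul, Real.norm_eq_abs]
      rcases le_total 0 r with hr | hr
      · rw [abs_of_nonneg hr]
        exact mul_le_mul_of_nonneg_left (le_csSup (𝓜.values_bddAbove x) ⟨μ, hμ, rfl⟩) hr
      · rw [abs_of_nonpos hr]
        have h := le_csSup (𝓜.values_bddAbove x) ⟨-μ, 𝓜.neg_mem μ hμ, rfl⟩
        change pairing x (-μ) ≤ _ at h
        rw [pairing_neg] at h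
        nlinarith [mul_le_mul_of_nonneg_left h (neg_nonneg.2 hr)])

/-- The Banach space `X_𝓜`, the completion of `(c_00, ‖·‖_𝓜)`. -/
abbrev Space : Type := CompletedC00 𝓜.norm

/-- The natural basis `(e_i)` of `X_𝓜`. -/
abbrev e (i : ℕ+) : 𝓜.Space := unitVec 𝓜.norm i

end NormingSet

/-! ### The mixed Tsirelson space `T(1/m_i, S_{n_i})` -/

/-- The implicit equation for the mixed Tsirelson norm: for every `x` in `c_00`,
`‖x‖ = max {‖x‖_∞, sup_j sup (1/m_j) ∑_{i ≤ k} ‖E_i x‖}`, the inner supremum being over all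
`S_{n_j}`-admissible families `E_1 < ⋯ < E_k`, where `E x` is the restriction of `x` to `E`. -/
def IsMixedTsirelsonNorm (m n : ℕ+ → ℕ) (q : Seminorm ℝ (ℕ+ →₀ ℝ)) : Prop :=
  ∀ x : ℕ+ →₀ ℝ, IsLUB
    ({r : ℝ | ∃ i, r = |x i|} ∪
      {r : ℝ | ∃ (j : ℕ+) (k : ℕ) (E : Fin k → Finset ℕ+), IsAdmissible (n j) E ∧
        r = 1 / (m j : ℝ) * ∑ i, q (x.filter (fun p => p ∈ E i))}) (q x)

/-- The mixed Tsirelson norm: the solution of the implicit equation.  (The supremum is the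
device which picks it from the set of all solutions, which has exactly one element.) -/
def mixedTsirelsonNorm (m n : ℕ+ → ℕ) : Seminorm ℝ (ℕ+ →₀ ℝ) :=
  sSup {q | IsMixedTsirelsonNorm m n q}

/-- The mixed Tsirelson space `T(1/m_i, S_{n_i})_{i=1}^∞`. -/
abbrev MixedTsirelson (m n : ℕ+ → ℕ) : Type := CompletedC00 (mixedTsirelsonNorm m n)

/-! ### `M`-good sets -/

/-- The sequence `f_j^N`: `f_1 = 1`, and for `j ≥ 2` it is the maximum of the sums
`∑_{i<j} ρ_i n_i` with `∏_{i<j} m_i^{ρ_i} < m_j^3`.  (This set of naturals is nonempty, and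
finite as soon as all `m_i ≥ 2`, so that `sSup` is its maximum.) -/
def fSeq (m n : ℕ+ → ℕ) (j : ℕ+) : ℕ :=
  if j = 1 then 1 else
    sSup {s : ℕ | ∃ ρ : ℕ+ → ℕ, ∏ i ∈ Finset.Ico 1 j, m i ^ ρ i < m j ^ 3 ∧
      s = ∑ i ∈ Finset.Ico 1 j, ρ i * n i}

/-- The standing assumptions on `M = (m_i)` and `L = (l_i)`. -/
structure IsParameterPair (m l : ℕ+ → ℕ) : Prop where
  strictMono_m : StrictMono m
  six_lt : 6 < m 1
  sq_lt : ∀ i, m i ^ 2 < m (i + 1)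
  strictMono_l : StrictMono l
  four_lt : 4 < l 1
  lt_two_pow : ∀ i, m i < 2 ^ l i

/-- `N = (n_i)` is `M`-good (with respect to the auxiliary set `L = (l_i)`). -/
structure IsGood (m l n : ℕ+ → ℕ) : Prop where
  strictMono_n : StrictMono n
  lt : ∀ j, l j * (fSeq m n j + 1) < n j

end

/-! The norm is given by the smallest set of functionals that contains `0` and the `± e_i^*` and is
closed under `(g_t) ↦ (1/m_j) ∑ g_t` over `S_{n_j}`-admissible families.  The supremum over this set
solves the implicit equation, and a solution is determined by induction on the size of the support.
The set is stable under changes of signs and under restrictions, which makes `(e_i)` an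
unconditional bimonotone basis; the operation of index `j` gives the lower `ℓ₁^{n_j}` estimate with
constant `1/m_j` for all normalized blocks.  The rest of the theorem depends on upper estimates for
suitable averages of blocks.

*Large averages* (`exists_large_average`).  Every block sequence has normalized blocks with an average
of order `f_i + 1` and of norm at least `1/2`: otherwise `l_i` iterated normalized averages would be
unit vectors with coefficients of sum at least `2 ^ l_i > m_i`, carried by a set in `S_{n_i}` because
`l_i (f_i + 1) < n_i`, and this contradicts the lower estimate.  Averages of order `f_i + 1` are small
on `S_{f_i}`, hence on `S_{n_r}` for `r < i`, so that a functional of weight `m_r` with `r < i` is at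
most `3/m_r` on the normalized large average (`abs_pairing_average_le`,
`exists_block_of_small_weights`).  Choosing such vectors with indices `i` that increase fast gives
rapidly increasing sequences: a functional of weight `m_r`, `r ≥ j`, is at most `3/m_j` on all members
but one (`exists_isRapid`).

*Averages of rapidly increasing sequences* (`exists_exceptional_sets`, `norm_average_le_of_isRapid`).
A norming functional is a tree of operations.  Cut each branch where an index `≥ j` appears or the
product of the weights reaches `m_j ^ 3`.  By the definition of `f_j` and the convolution property
`S_a[S_b] ⊆ S_{a+b}`, the functionals where the branches are cut form an `S_{f_j}`-admissible family.
The vectors that are split between several of them, or that are exceptional for one of them, are thus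
indexed by two sets in `S_{f_j}`, where an average of order `f_j + 1` has little mass; on all other
vectors the functional is at most `3/m_j + 1/m_j ^ 2`.  So the average has norm less than `6/m_j`.

This bounds `τ` by `f_j`, since `S_{f_j + 1}` carries the coefficients of the average.  The basis is
shrinking, since a functional bounded below on a block sequence would be bounded below on such averages.
Finally, the norm `sup ∑ ‖E_i x‖` over `S_{n_j}`-admissible families is at least `1` on these averages,
of norm less than `6/m_j`, and at most `3` on unit vectors built from large averages with an index
`i > j`; a gliding hump brings both kinds of vectors into every infinite-dimensional subspace. -/

noncomputable section

open NormingSet (pairing)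

/-! ### Schreier families -/

theorem FinsetLT.mono {E E' F F' : Finset ℕ+} (h : FinsetLT E F) (hE : E' ⊆ E) (hF : F' ⊆ F) :
    FinsetLT E' F' :=
  fun a ha b hb => h a (hE ha) b (hF hb)

theorem empty_mem_schreier (ξ : ℕ) : ∅ ∈ schreier ξ := by
  cases ξ <;> exact Or.inl rfl

/-- `IsUnionOf ξ k F`: the set `F` is the union of `k` successive, possibly empty, elements
of `S_ξ`. -/
def IsUnionOf (ξ : ℕ) : ℕ → Finset ℕ+ → Prop
  | 0, F => F = ∅
  | k + 1, F => ∃ G H : Finset ℕ+, F = G ∪ H ∧ FinsetLT G H ∧ G ∈ schreier ξ ∧ IsUnionOf ξ k H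

theorem isUnionOf_biUnion {ξ : ℕ} : ∀ (k : ℕ) (E : Fin k → Finset ℕ+),
    (∀ i, E i ∈ schreier ξ) → (∀ i j, i < j → FinsetLT (E i) (E j)) →
    IsUnionOf ξ k (Finset.univ.biUnion E)
  | 0, E, _, _ => by simp [IsUnionOf]
  | k + 1, E, hE, hlt => by
    refine ⟨E 0, Finset.univ.biUnion fun i : Fin k => E i.succ, ?_, ?_, hE 0,
      isUnionOf_biUnion k _ (fun i => hE _) fun i j hij => hlt _ _ (Fin.succ_lt_succ_iff.2 hij)⟩
    · ext p
      simp [Fin.exists_fin_succ]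
    · intro a ha b hb
      obtain ⟨i, -, hi⟩ := Finset.mem_biUnion.1 hb
      exact hlt 0 i.succ (Fin.succ_pos i) a ha b hi

theorem IsUnionOf.exists_nonempty {ξ : ℕ} : ∀ {k : ℕ} {F : Finset ℕ+}, IsUnionOf ξ k F →
    ∃ k' ≤ k, ∃ E : Fin k' → Finset ℕ+, (∀ i, (E i).Nonempty ∧ E i ∈ schreier ξ) ∧
      (∀ i j, i < j → FinsetLT (E i) (E j)) ∧ F = Finset.univ.biUnion E
  | 0, F, h => ⟨0, le_rfl, Fin.elim0, fun i => i.elim0, fun i => i.elim0, by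
      simpa [IsUnionOf] using h⟩
  | k + 1, F, ⟨G, H, hF, hlt, hG, hH⟩ => by
    obtain ⟨k', hk', E, hE, hE', rfl⟩ := hH.exists_nonempty
    rcases G.eq_empty_or_nonempty with rfl | hne
    · exact ⟨k', by omega, E, hE, hE', by simpa using hF⟩
    · refine ⟨k' + 1, by omega, Fin.cons G E, ?_, ?_, ?_⟩
      · intro i
        refine Fin.cases ⟨hne, hG⟩ (fun i => ?_) i
        simpa using hE i
      · intro i j
        refine Fin.cases ?_ (fun i => ?_) i <;> refine Fin.cases ?_ (fun j => ?_) j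
        · simp
        · intro _
          simpa using hlt.mono le_rfl
            (Finset.subset_biUnion_of_mem E (Finset.mem_univ j))
        · simp
        · intro h
          simpa using hE' i j (Fin.succ_lt_succ_iff.1 h)
      · rw [hF]
        ext p
        simp [Fin.exists_fin_succ]

/-- Empty pieces are harmless in the definition of `S_{ξ+1}`. -/
theorem mem_schreier_succ {ξ : ℕ} {F : Finset ℕ+} :
    F ∈ schreier (ξ + 1) ↔ ∃ k : ℕ, (∀ p ∈ F, k ≤ (p : ℕ)) ∧ IsUnionOf ξ k F := by
  constructor
  · rintro (rfl | ⟨k, E, hE, hlt, hk, rfl⟩)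
    · exact ⟨0, by simp, rfl⟩
    · refine ⟨k, ?_, isUnionOf_biUnion k E (fun i => (hE i).2) hlt⟩
      intro p hp
      obtain ⟨i, -, hi⟩ := Finset.mem_biUnion.1 hp
      exact hk i p hi
  · rintro ⟨k, hk, hF⟩
    obtain ⟨k', hk', E, hE, hlt, rfl⟩ := hF.exists_nonempty
    exact Or.inr ⟨k', E, hE, hlt, fun i p hp =>
      hk'.trans (hk p (Finset.mem_biUnion.2 ⟨i, Finset.mem_univ i, hp⟩)), rfl⟩

theorem schreier_subset_succ (ξ : ℕ) : schreier ξ ⊆ schreier (ξ + 1) := fun F hF =>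
  mem_schreier_succ.2 ⟨1, fun p _ => p.2, F, ∅, by simp, by simp [FinsetLT], hF, rfl⟩

theorem schreier_mono : Monotone schreier := monotone_nat_of_le_succ schreier_subset_succ

theorem singleton_mem_schreier (ξ : ℕ) (p : ℕ+) : {p} ∈ schreier ξ :=
  schreier_mono (Nat.zero_le ξ) (Or.inr ⟨p, rfl⟩)

theorem mem_schreier_of_card_le_one (ξ : ℕ) {F : Finset ℕ+} (hF : F.card ≤ 1) :
    F ∈ schreier ξ := by
  rcases Finset.card_le_one_iff_subset_singleton.1 hF with ⟨p, hp⟩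
  rcases Finset.subset_singleton_iff.1 hp with rfl | rfl
  · exact empty_mem_schreier ξ
  · exact singleton_mem_schreier ξ p

/-- The convolution property of the Schreier families: replacing every point `t` of a set in
`S_a` by a set in `S_b` lying to the right of `t` gives a set in `S_{a+b}`.  The pieces may be
empty, so that this contains the facts that the families are hereditary and spreading. -/
theorem biUnion_mem_schreier {a b : ℕ} {A : Finset ℕ+} {H : ℕ+ → Finset ℕ+}
    (hA : A ∈ schreier a) (hH : ∀ t ∈ A, H t ∈ schreier b) (hle : ∀ t ∈ A, ∀ p ∈ H t, t ≤ p)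
    (hlt : ∀ t ∈ A, ∀ t' ∈ A, t < t' → FinsetLT (H t) (H t')) :
    A.biUnion H ∈ schreier (a + b) := by
  induction a generalizing A with
  | zero =>
    rw [Nat.zero_add]
    rcases hA with rfl | ⟨i, rfl⟩
    · simpa using empty_mem_schreier b
    · simpa using hH i (Finset.mem_singleton_self i)
  | succ a ih =>
    obtain ⟨k, hk, hA⟩ := mem_schreier_succ.1 hA
    have key : ∀ (k : ℕ) (B : Finset ℕ+), B ⊆ A → IsUnionOf a k B →
        IsUnionOf (a + b) k (B.biUnion H) := by
      intro k
      induction k with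
      | zero =>
        intro B _ hB
        simp only [IsUnionOf] at hB ⊢
        simp [hB]
      | succ k ihk =>
        rintro B hBA ⟨G, K, rfl, hGK, hG, hK⟩
        have hGA := Finset.union_subset_left hBA
        have hKA := Finset.union_subset_right hBA
        refine ⟨G.biUnion H, K.biUnion H, by rw [Finset.union_biUnion], ?_, ?_, ihk K hKA hK⟩
        · intro p hp r hr
          obtain ⟨t, ht, hpt⟩ := Finset.mem_biUnion.1 hp
          obtain ⟨t', ht', hrt⟩ := Finset.mem_biUnion.1 hr
          exact hlt t (hGA ht) t' (hKA ht') (hGK t ht t' ht') p hpt r hrt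
        · exact ih hG (fun t ht => hH t (hGA ht)) (fun t ht => hle t (hGA ht))
            fun t ht t' ht' => hlt t (hGA ht) t' (hGA ht')
    rw [Nat.succ_add, mem_schreier_succ]
    refine ⟨k, ?_, key k A le_rfl hA⟩
    intro p hp
    obtain ⟨t, ht, hpt⟩ := Finset.mem_biUnion.1 hp
    exact (hk t ht).trans (hle t ht p hpt)

theorem schreier_hereditary {ξ : ℕ} {A B : Finset ℕ+} (hA : A ∈ schreier ξ) (hB : B ⊆ A) :
    B ∈ schreier ξ := by
  have h := biUnion_mem_schreier (b := 0) (H := fun t => if t ∈ B then {t} else ∅) hA ?_ ?_ ?_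
  · rw [Nat.add_zero] at h
    convert h using 1
    ext p
    simp only [Finset.mem_biUnion]
    constructor
    · exact fun hp => ⟨p, hB hp, by simp [hp]⟩
    · rintro ⟨t, -, ht⟩
      split_ifs at ht with h'
      · rwa [Finset.mem_singleton.1 ht]
      · simp at ht
  · intro t _
    split_ifs
    · exact singleton_mem_schreier 0 t
    · exact empty_mem_schreier 0
  · intro t _ p hp
    split_ifs at hp
    · exact (Finset.mem_singleton.1 hp).ge
    · simp at hp
  · intro t _ t' _ htt p hp r hr
    split_ifs at hp hr
    all_goals simp_all

/-- The Schreier families are spreading.  Here the set `{w l : l ∈ L}` lies to the right of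
`{τ l : l ∈ L}`, which is a subset of `A`. -/
theorem image_mem_schreier {ξ : ℕ} {A L : Finset ℕ+} {w τ : ℕ+ → ℕ+} (hA : A ∈ schreier ξ)
    (hτA : ∀ l ∈ L, τ l ∈ A) (hτw : ∀ l ∈ L, τ l ≤ w l)
    (hτ : ∀ l ∈ L, ∀ l' ∈ L, l < l' → τ l < τ l')
    (hw : ∀ l ∈ L, ∀ l' ∈ L, l < l' → w l < w l') :
    L.image w ∈ schreier ξ := by
  have h := biUnion_mem_schreier (b := 0) (H := fun t => (L.filter fun l => τ l = t).image w)
    hA ?_ ?_ ?_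
  · rw [Nat.add_zero] at h
    convert h using 1
    ext p
    simp only [Finset.mem_biUnion, Finset.mem_image, Finset.mem_filter]
    constructor
    · rintro ⟨l, hl, rfl⟩
      exact ⟨τ l, hτA l hl, l, ⟨hl, rfl⟩, rfl⟩
    · rintro ⟨t, -, l, ⟨hl, -⟩, rfl⟩
      exact ⟨l, hl, rfl⟩
  · intro t _
    refine mem_schreier_of_card_le_one 0 (Finset.card_image_le.trans ?_)
    refine Finset.card_le_one.2 fun l hl l' hl' => ?_
    rw [Finset.mem_filter] at hl hl'
    rcases lt_trichotomy l l' with h | h | h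
    · exact absurd (hτ l hl.1 l' hl'.1 h) (by rw [hl.2, hl'.2]; exact lt_irrefl _)
    · exact h
    · exact absurd (hτ l' hl'.1 l hl.1 h) (by rw [hl.2, hl'.2]; exact lt_irrefl _)
  · intro t _ p hp
    obtain ⟨l, hl, rfl⟩ := Finset.mem_image.1 hp
    rw [Finset.mem_filter] at hl
    rw [← hl.2]
    exact hτw l hl.1
  · intro t _ t' _ htt p hp r hr
    obtain ⟨l, hl, rfl⟩ := Finset.mem_image.1 hp
    obtain ⟨l', hl', rfl⟩ := Finset.mem_image.1 hr
    rw [Finset.mem_filter] at hl hl'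
    refine hw l hl.1 l' hl'.1 ?_
    by_contra hc
    rcases (not_lt.1 hc).lt_or_eq with h | h
    · have := hτ l' hl'.1 l hl.1 h
      rw [hl.2, hl'.2] at this
      exact absurd htt this.asymm
    · rw [← hl.2, ← hl'.2, h] at htt
      exact lt_irrefl _ htt

/-! ### Sequences chosen one after the other -/

/-- Dependent choice along `ℕ+`. -/
theorem exists_pnat_seq {α : Type*} {P : α → Prop} {R : α → α → Prop} (h0 : ∃ a, P a)
    (hs : ∀ a, P a → ∃ b, P b ∧ R a b) : ∃ s : ℕ+ → α, ∀ i, P (s i) ∧ R (s i) (s (i + 1)) := by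
  obtain ⟨a0, ha0⟩ := h0
  choose! g hg using hs
  let s : ℕ → α := fun k => g^[k] a0
  have hs : ∀ k, P (s k) := by
    intro k
    induction k with
    | zero => exact ha0
    | succ k ih =>
      simp only [s, Function.iterate_succ_apply']
      exact (hg _ ih).1
  refine ⟨fun i => s i.natPred, fun i => ⟨hs _, ?_⟩⟩
  have h : (i + 1).natPred = i.natPred + 1 := by
    have := i.pos
    simp only [PNat.natPred, PNat.add_coe, PNat.one_coe]
    omega
  simp only [h, s, Function.iterate_succ_apply']
  exact (hg _ (hs i.natPred)).2

theorem pnat_rel_of_lt {α : Type*} {R : α → α → Prop} {s : ℕ+ → α}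
    (htrans : ∀ a b c, R a b → R b c → R a c) (h : ∀ i, R (s i) (s (i + 1))) {i j : ℕ+}
    (hij : i < j) : R (s i) (s j) := by
  induction j using PNat.recOn with
  | one => exact absurd hij (not_lt_one)
  | succ j ih =>
    rcases (PNat.lt_add_one_iff.1 hij).lt_or_eq with h' | rfl
    · exact htrans _ _ _ (ih h') (h j)
    · exact h i

/-- Dependent choice of objects with successive supports. -/
theorem exists_successive_seq {α : Type*} (supp : α → Finset ℕ+) {P : α → Prop}
    {R : α → α → Prop} (h0 : ∃ a, P a) (hne : ∀ a, P a → (supp a).Nonempty)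
    (hs : ∀ a, P a → ∀ N : ℕ+, ∃ b, P b ∧ R a b ∧ ∀ p ∈ supp b, N ≤ p) :
    ∃ s : ℕ+ → α, (∀ i, P (s i)) ∧ (∀ i, R (s i) (s (i + 1))) ∧
      ∀ i j, i < j → FinsetLT (supp (s i)) (supp (s j)) := by
  obtain ⟨s, hs⟩ := exists_pnat_seq (P := P)
    (R := fun a b => R a b ∧ (supp b).Nonempty ∧ FinsetLT (supp a) (supp b)) h0 (fun a ha => by
      obtain ⟨b, hb, hR, hN⟩ := hs a ha ((supp a).sup id + 1)
      refine ⟨b, hb, hR, hne b hb, fun p hp r hr => PNat.add_one_le_iff.1 ?_⟩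
      exact (add_le_add_left (Finset.le_sup (f := id) hp) 1).trans (hN r hr))
  refine ⟨s, fun i => (hs i).1, fun i => (hs i).2.1, fun i j hij => ?_⟩
  refine (pnat_rel_of_lt (s := s)
    (R := fun a b => (supp b).Nonempty ∧ FinsetLT (supp a) (supp b)) ?_
    (fun i => (hs i).2.2) hij).2
  rintro a b c ⟨⟨r, hr⟩, hab⟩ ⟨hc, hbc⟩
  exact ⟨hc, fun p hp t ht => (hab p hp r hr).trans (hbc r hr t ht)⟩

/-! ### Averages that are small on Schreier sets -/

/-- The sum of the coefficients of a vector of `c_00`. -/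
def coeffSum : (ℕ+ →₀ ℝ) →ₗ[ℝ] ℝ := Finsupp.linearCombination ℝ fun _ => (1 : ℝ)

theorem coeffSum_apply (b : ℕ+ →₀ ℝ) : coeffSum b = ∑ i ∈ b.support, b i := by
  simp [coeffSum, Finsupp.linearCombination_apply, Finsupp.sum]

theorem sum_le_coeffSum {b : ℕ+ →₀ ℝ} (hb : 0 ≤ b) (B : Finset ℕ+) :
    ∑ i ∈ B, b i ≤ coeffSum b := by
  rw [coeffSum_apply]
  calc ∑ i ∈ B, b i = ∑ i ∈ B ∩ b.support, b i :=
        (Finset.sum_subset Finset.inter_subset_left fun i hi h => by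
          by_contra hne
          exact h (Finset.mem_inter.2 ⟨hi, Finsupp.mem_support_iff.2 hne⟩)).symm
    _ ≤ ∑ i ∈ b.support, b i :=
        Finset.sum_le_sum_of_subset_of_nonneg Finset.inter_subset_right fun i _ _ => hb i

/-- The coefficients `b` put mass at most `ε` on every set of indices whose locations, given
by `w`, form a set of the family `S_ξ`. -/
def IsSmallOn (w : ℕ+ → ℕ+) (ξ : ℕ) (ε : ℝ) (b : ℕ+ →₀ ℝ) : Prop :=
  ∀ B : Finset ℕ+, B.image w ∈ schreier ξ → ∑ i ∈ B, b i ≤ ε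

theorem IsSmallOn.mono {w : ℕ+ → ℕ+} {ξ ζ : ℕ} {ε δ : ℝ} {b : ℕ+ →₀ ℝ} (h : IsSmallOn w ξ ε b)
    (hζ : ζ ≤ ξ) (hε : ε ≤ δ) : IsSmallOn w ζ δ b :=
  fun B hB => (h B (schreier_mono hζ hB)).trans hε

theorem IsSmallOn.sum_le_of_isUnionOf {w : ℕ+ → ℕ+} {ξ : ℕ} {ε : ℝ} {b : ℕ+ →₀ ℝ}
    (h : IsSmallOn w ξ ε b) : ∀ {k : ℕ} {F B : Finset ℕ+}, IsUnionOf ξ k F → B.image w ⊆ F →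
    ∑ i ∈ B, b i ≤ k * ε
  | 0, F, B, hF, hB => by
    simp only [IsUnionOf] at hF
    rw [hF, Finset.subset_empty, Finset.image_eq_empty] at hB
    simp [hB]
  | k + 1, F, B, ⟨G, H, hF, _, hG, hH⟩, hB => by
    rw [← Finset.sum_filter_add_sum_filter_not B (fun i => w i ∈ G)]
    have h1 : ∑ i ∈ B.filter (fun i => w i ∈ G), b i ≤ ε := by
      refine h _ (schreier_hereditary hG ?_)
      intro p hp
      obtain ⟨i, hi, rfl⟩ := Finset.mem_image.1 hp
      exact (Finset.mem_filter.1 hi).2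
    have h2 : ∑ i ∈ B.filter (fun i => ¬ w i ∈ G), b i ≤ k * ε := by
      refine h.sum_le_of_isUnionOf hH ?_
      intro p hp
      obtain ⟨i, hi, rfl⟩ := Finset.mem_image.1 hp
      rw [Finset.mem_filter] at hi
      have := hB (Finset.mem_image_of_mem w hi.1)
      rw [hF, Finset.mem_union] at this
      exact this.resolve_left hi.2
    push_cast
    linarith

/-- Repeated averages: there are convex combinations of order `ξ` that are small on all
families of smaller order, the smallness being measured by the locations `w`. -/
theorem exists_average {w : ℕ+ → ℕ+} (hw : StrictMono w) (ξ : ℕ) : ∀ {ε : ℝ}, 0 < ε → ∀ N : ℕ+,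
    ∃ b : ℕ+ →₀ ℝ, 0 ≤ b ∧ coeffSum b = 1 ∧ b.support ∈ schreier ξ ∧ (∀ i ∈ b.support, N ≤ i) ∧
      ∀ ζ < ξ, IsSmallOn w ζ ε b := by
  induction ξ with
  | zero =>
    intro ε _ N
    refine ⟨Finsupp.single N 1, Finsupp.single_nonneg.2 zero_le_one, by simp [coeffSum], ?_, ?_,
      fun ζ hζ => absurd hζ (Nat.not_lt_zero ζ)⟩
    · rw [Finsupp.support_single N one_ne_zero]
      exact singleton_mem_schreier 0 N
    · intro i hi
      rw [Finsupp.support_single N one_ne_zero, Finset.mem_singleton] at hi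
      exact hi.ge
  | succ ξ ih =>
    intro ε hε N
    obtain ⟨k, hk⟩ := exists_nat_gt (2 / ε)
    have hk0 : (0 : ℝ) < k := (div_pos two_pos hε).trans hk
    have hkn : 0 < k := by exact_mod_cast hk0
    have hkε : 2 / (k : ℝ) ≤ ε := by
      rw [div_le_iff₀ hk0]
      rw [div_lt_iff₀ hε] at hk
      linarith
    obtain ⟨s, hs⟩ := exists_pnat_seq (α := ℕ+ →₀ ℝ)
      (P := fun b => 0 ≤ b ∧ coeffSum b = 1 ∧ b.support ∈ schreier ξ ∧
        ∀ i ∈ b.support, max N ⟨k, hkn⟩ ≤ i)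
      (R := fun a b => b.support.Nonempty ∧ FinsetLT a.support b.support ∧
        ∀ p ∈ a.support, ∀ ζ < ξ, IsSmallOn w ζ (1 / (k * (w p : ℕ))) b)
      (by
        obtain ⟨b, h1, h2, h3, h4, -⟩ := ih one_pos (max N ⟨k, hkn⟩)
        exact ⟨b, h1, h2, h3, h4⟩)
      (by
        rintro a -
        have hpos : (0 : ℝ) < 1 / (k * (w (a.support.sup id) : ℕ)) := by
          have := (w (a.support.sup id)).pos
          positivity
        obtain ⟨b, h1, h2, h3, h4, h5⟩ := ih hpos
          (max (max N ⟨k, hkn⟩) (a.support.sup id + 1))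
        refine ⟨b, ⟨h1, h2, h3, fun i hi => (le_max_left _ _).trans (h4 i hi)⟩, ?_, ?_, ?_⟩
        · by_contra hne
          rw [Finset.not_nonempty_iff_eq_empty] at hne
          rw [coeffSum_apply, hne] at h2
          simp at h2
        · intro p hp r hr
          exact PNat.add_one_le_iff.1 (((add_le_add_left (Finset.le_sup (f := id) hp) 1).trans
            (le_max_right _ _)).trans (h4 r hr))
        · intro p hp ζ hζ
          refine (h5 ζ hζ).mono le_rfl ?_
          have h6 : (w p : ℕ) ≤ w (a.support.sup id) :=
            hw.monotone (Finset.le_sup (f := id) hp)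
          have h7 : (0 : ℝ) < (w p : ℕ) := by exact_mod_cast (w p).pos
          gcongr)
    have hlt : ∀ i j, i < j → (s j).support.Nonempty ∧ FinsetLT (s i).support (s j).support ∧
        ∀ p ∈ (s i).support, ∀ ζ < ξ, IsSmallOn w ζ (1 / (k * (w p : ℕ))) (s j) := by
      intro i j hij
      refine pnat_rel_of_lt (s := s) (R := fun a b => b.support.Nonempty ∧
        FinsetLT a.support b.support ∧
        ∀ p ∈ a.support, ∀ ζ < ξ, IsSmallOn w ζ (1 / (k * (w p : ℕ))) b) ?_
        (fun i => (hs i).2) hij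
      rintro a b c ⟨⟨r, hr⟩, hab, -⟩ ⟨hc, hbc, h⟩
      refine ⟨hc, fun p hp t ht => (hab p hp r hr).trans (hbc r hr t ht), fun p hp ζ hζ => ?_⟩
      refine (h r hr ζ hζ).mono le_rfl ?_
      have h6 : (w p : ℕ) ≤ w r := hw.monotone (hab p hp r hr).le
      have h7 : (0 : ℝ) < (w p : ℕ) := by exact_mod_cast (w p).pos
      gcongr
    let t : Fin k → ℕ+ := fun i => Nat.succPNat i
    have ht : ∀ i j, i < j → t i < t j := fun i j hij => Nat.succPNat_lt_succPNat.2 hij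
    have hsupp : ((k : ℝ)⁻¹ • ∑ i, s (t i)).support ⊆
        Finset.univ.biUnion fun i => (s (t i)).support :=
      Finsupp.support_smul.trans Finsupp.support_finsetSum
    have hmem : ∀ p ∈ ((k : ℝ)⁻¹ • ∑ i, s (t i)).support, max N ⟨k, hkn⟩ ≤ p := by
      intro p hp
      obtain ⟨i, -, hi⟩ := Finset.mem_biUnion.1 (hsupp hp)
      exact (hs (t i)).1.2.2.2 p hi
    have hsmall : ∀ B : Finset ℕ+, B.image w ∈ schreier ξ →
        ∑ p ∈ B, ((k : ℝ)⁻¹ • ∑ i, s (t i)) p ≤ ε := by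
      intro B hB
      have hsum : ∑ p ∈ B, ((k : ℝ)⁻¹ • ∑ i, s (t i)) p
          = (k : ℝ)⁻¹ * ∑ i, ∑ p ∈ B, s (t i) p := by
        rw [Finset.sum_comm, Finset.mul_sum]
        simp
      -- Only the first piece met by `B` can carry a substantial part of its mass.
      have hmain : ∃ i0 : Fin k, ∀ i, ∑ p ∈ B, s (t i) p ≤ (if i = i0 then 1 else 0) + 1 / k := by
        by_cases hne : ∃ i, ∃ p ∈ B, p ∈ (s (t i)).support
        · have hne' : (Finset.univ.filter fun i => ∃ p ∈ B, p ∈ (s (t i)).support).Nonempty := by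
            obtain ⟨i, hi⟩ := hne
            exact ⟨i, by simpa using hi⟩
          obtain ⟨i0, hi0, hmin⟩ := Finset.exists_min_image _ id hne'
          obtain ⟨-, p0, hp0B, hp0⟩ := Finset.mem_filter.1 hi0
          refine ⟨i0, fun i => ?_⟩
          have hzero : (∀ p ∈ B, p ∉ (s (t i)).support) → ∑ p ∈ B, s (t i) p = 0 := fun h =>
            Finset.sum_eq_zero fun p hp => Finsupp.notMem_support_iff.1 (h p hp)
          rcases lt_trichotomy i i0 with h | rfl | h
          · rw [hzero, if_neg h.ne]
            · positivity
            · intro p hp hps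
              exact absurd (hmin i (Finset.mem_filter.2 ⟨Finset.mem_univ i, p, hp, hps⟩))
                (not_le.2 h)
          · rw [if_pos rfl]
            have h1 := sum_le_coeffSum (hs (t i)).1.1 B
            rw [(hs (t i)).1.2.1] at h1
            have : (0 : ℝ) ≤ 1 / k := by positivity
            linarith
          · rw [if_neg h.ne', zero_add]
            cases ξ with
            | zero =>
              rw [hzero]
              · positivity
              intro p hp hps
              have hpp : w p = w p0 := by
                rcases hB with hB | ⟨x, hx⟩
                · rw [Finset.image_eq_empty] at hB
                  simp [hB] at hp
                · have h1 := hx ▸ Finset.mem_image_of_mem w hp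
                  have h2 := hx ▸ Finset.mem_image_of_mem w hp0B
                  rw [Finset.mem_singleton] at h1 h2
                  rw [h1, h2]
              have := (hlt _ _ (ht _ _ h)).2.1 p0 hp0 p hps
              rw [hw.injective hpp] at this
              exact lt_irrefl _ this
            | succ η =>
              obtain ⟨r, hr, hu⟩ := mem_schreier_succ.1 hB
              have hrp := hr _ (Finset.mem_image_of_mem w hp0B)
              have h1 := ((hlt _ _ (ht _ _ h)).2.2 p0 hp0 η (Nat.lt_succ_self η)).sum_le_of_isUnionOf
                hu le_rfl
              refine h1.trans ?_
              have hwp : (0 : ℝ) < (w p0 : ℕ) := by exact_mod_cast (w p0).pos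
              have hrp' : (r : ℝ) ≤ (w p0 : ℕ) := by exact_mod_cast hrp
              calc (r : ℝ) * (1 / (k * (w p0 : ℕ))) ≤ (w p0 : ℕ) * (1 / (k * (w p0 : ℕ))) := by
                    gcongr
                _ = 1 / k := by field_simp
        · push Not at hne
          refine ⟨⟨0, hkn⟩, fun i => ?_⟩
          rw [Finset.sum_eq_zero fun p hp => Finsupp.notMem_support_iff.1 (hne i p hp)]
          positivity
      obtain ⟨i0, hi0⟩ := hmain
      rw [hsum]
      calc (k : ℝ)⁻¹ * ∑ i, ∑ p ∈ B, s (t i) p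
          ≤ (k : ℝ)⁻¹ * ∑ i : Fin k, ((if i = i0 then 1 else 0) + 1 / (k : ℝ)) := by
            gcongr with i
            exact hi0 i
        _ = 2 / k := by
            rw [Finset.sum_add_distrib]
            simp
            field_simp
            norm_num
        _ ≤ ε := hkε
    refine ⟨(k : ℝ)⁻¹ • ∑ i, s (t i), ?_, ?_, ?_, fun i hi => (le_max_left _ _).trans (hmem i hi),
      fun ζ hζ => IsSmallOn.mono hsmall (Nat.lt_succ_iff.1 hζ) le_rfl⟩
    · exact smul_nonneg (by positivity) (Finset.sum_nonneg fun i _ => (hs (t i)).1.1)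
    · rw [map_smul, map_sum, Finset.sum_congr rfl fun i _ => (hs (t i)).1.2.1]
      simp [hk0.ne']
    · refine mem_schreier_succ.2 ⟨k, fun p hp => ?_, ?_⟩
      · exact (le_max_right N ⟨k, hkn⟩).trans (hmem p hp)
      · have hE : ((k : ℝ)⁻¹ • ∑ i, s (t i)).support =
            Finset.univ.biUnion fun i => (s (t i)).support ∩ ((k : ℝ)⁻¹ • ∑ i, s (t i)).support := by
          rw [← Finset.biUnion_inter, Finset.inter_eq_right.2 hsupp]
        rw [hE]
        refine isUnionOf_biUnion k _ (fun i => schreier_hereditary (hs (t i)).1.2.2.1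
          Finset.inter_subset_left) fun i j hij => ?_
        exact ((hlt _ _ (ht i j hij)).2.1).mono Finset.inter_subset_left Finset.inter_subset_left

section

/-! ### Pairings and successive supports -/

theorem pairing_eq_linearCombination (x μ : ℕ+ →₀ ℝ) :
    pairing x μ = Finsupp.linearCombination ℝ (⇑μ) x := rfl

theorem pairing_sum_left {ι : Type*} (s : Finset ι) (x : ι → ℕ+ →₀ ℝ) (μ : ℕ+ →₀ ℝ) :
    pairing (∑ i ∈ s, x i) μ = ∑ i ∈ s, pairing (x i) μ := by
  simp only [pairing_eq_linearCombination, map_sum]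

theorem pairing_comm (x μ : ℕ+ →₀ ℝ) : pairing x μ = pairing μ x := by
  have h : ∀ y z : ℕ+ →₀ ℝ, pairing y z = ∑ i ∈ y.support ∩ z.support, y i * z i := by
    intro y z
    refine (Finset.sum_subset Finset.inter_subset_left fun i hi h => ?_).symm
    have : z i = 0 := by
      by_contra hne
      exact h (Finset.mem_inter.2 ⟨hi, Finsupp.mem_support_iff.2 hne⟩)
    simp [this]
  rw [h, h, Finset.inter_comm]
  exact Finset.sum_congr rfl fun i _ => mul_comm _ _

theorem pairing_sum_right {ι : Type*} (s : Finset ι) (x : ℕ+ →₀ ℝ) (μ : ι → ℕ+ →₀ ℝ) :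
    pairing x (∑ i ∈ s, μ i) = ∑ i ∈ s, pairing x (μ i) := by
  rw [pairing_comm, pairing_sum_left]
  exact Finset.sum_congr rfl fun i _ => pairing_comm _ _

theorem pairing_smul_right (r : ℝ) (x μ : ℕ+ →₀ ℝ) : pairing x (r • μ) = r * pairing x μ := by
  rw [pairing_comm, NormingSet.pairing_smul, pairing_comm]

theorem pairing_single_right (x : ℕ+ →₀ ℝ) (i : ℕ+) (r : ℝ) :
    pairing x (Finsupp.single i r) = x i * r := by
  rw [pairing_comm]
  simp [pairing, mul_comm]

/-- Moving a multiplier from one side of the pairing to the other. -/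
theorem pairing_smul_pointwise (h : ℕ+ → ℝ) (x μ : ℕ+ →₀ ℝ) :
    pairing (h • x) μ = pairing x (h • μ) := by
  have h1 : pairing (h • x) μ = ∑ i ∈ x.support, (h • x) i * μ i := by
    refine Finset.sum_subset (fun i hi => ?_) fun i _ hi => ?_
    · rw [Finsupp.mem_support_iff] at hi ⊢
      intro h0
      simp [h0] at hi
    · simp [Finsupp.notMem_support_iff.1 hi]
  rw [h1]
  refine Finset.sum_congr rfl fun i _ => ?_
  simp
  ring

theorem pairing_linearCombination (u : ℕ+ → ℕ+ →₀ ℝ) (c μ : ℕ+ →₀ ℝ) :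
    pairing (Finsupp.linearCombination ℝ u c) μ = ∑ t ∈ c.support, c t * pairing (u t) μ := by
  rw [Finsupp.linearCombination_apply, Finsupp.sum, pairing_sum_left]
  exact Finset.sum_congr rfl fun t _ => NormingSet.pairing_smul _ _ _

theorem pairing_eq_zero {x μ : ℕ+ →₀ ℝ} (h : ∀ p ∈ μ.support, p ∉ x.support) :
    pairing x μ = 0 :=
  Finset.sum_eq_zero fun p hp => by
    have : μ p = 0 := by
      by_contra hne
      exact h p (Finsupp.mem_support_iff.2 hne) hp
    simp [this]

theorem abs_pairing_le_of_abs_le {x μ : ℕ+ →₀ ℝ} {r : ℝ} (h : ∀ i, |μ i| ≤ r) :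
    |pairing x μ| ≤ r * ∑ i ∈ x.support, |x i| := by
  rw [Finset.mul_sum]
  refine (Finset.abs_sum_le_sum_abs _ _).trans (Finset.sum_le_sum fun i _ => ?_)
  rw [abs_mul, mul_comm]
  exact mul_le_mul_of_nonneg_right (h i) (abs_nonneg _)

/-- The vectors `u n` have successive supports. -/
def IsSuccessive (u : ℕ+ → ℕ+ →₀ ℝ) : Prop :=
  ∀ i j, i < j → FinsetLT (u i).support (u j).support

/-- The last point of the support of `u n` (or `1` if `u n = 0`). -/
def lastPoint (u : ℕ+ → ℕ+ →₀ ℝ) (n : ℕ+) : ℕ+ := (u n).support.sup id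

theorem le_lastPoint {u : ℕ+ → ℕ+ →₀ ℝ} {n p : ℕ+} (hp : p ∈ (u n).support) :
    p ≤ lastPoint u n :=
  Finset.le_sup (f := id) hp

theorem lastPoint_mem {u : ℕ+ → ℕ+ →₀ ℝ} {n : ℕ+} (h : u n ≠ 0) :
    lastPoint u n ∈ (u n).support := by
  obtain ⟨p, hp, h⟩ := Finset.exists_mem_eq_sup _ (Finsupp.support_nonempty_iff.2 h) id
  rw [lastPoint, h]
  exact hp

namespace IsSuccessive

variable {u : ℕ+ → ℕ+ →₀ ℝ}

theorem strictMono_lastPoint (hu : IsSuccessive u) (h0 : ∀ n, u n ≠ 0) :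
    StrictMono (lastPoint u) :=
  fun i j hij => hu i j hij _ (lastPoint_mem (h0 i)) _ (lastPoint_mem (h0 j))

theorem eq_of_mem (hu : IsSuccessive u) {i j p : ℕ+} (hi : p ∈ (u i).support)
    (hj : p ∈ (u j).support) : i = j := by
  rcases lt_trichotomy i j with h | h | h
  · exact absurd (hu i j h p hi p hj) (lt_irrefl p)
  · exact h
  · exact absurd (hu j i h p hj p hi) (lt_irrefl p)

theorem le_of_lt (hu : IsSuccessive u) {i j p q : ℕ+} (hi : p ∈ (u i).support)
    (hj : q ∈ (u j).support) (hpq : p < q) : i ≤ j := by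
  by_contra h
  exact (hu j i (not_le.1 h) q hj p hi).asymm hpq

theorem le_of_mem (hu : IsSuccessive u) (h0 : ∀ n, u n ≠ 0) {n p : ℕ+}
    (hp : p ∈ (u n).support) : n ≤ p := by
  induction n using PNat.recOn generalizing p with
  | one => exact one_le
  | succ n ih =>
    have h1 := ih (lastPoint_mem (h0 n))
    exact PNat.add_one_le_iff.2 (h1.trans_lt
      (hu n (n + 1) (PNat.lt_add_right n 1) _ (lastPoint_mem (h0 n)) p hp))

theorem comp (hu : IsSuccessive u) {k : ℕ+ → ℕ+} (hk : StrictMono k) : IsSuccessive (u ∘ k) :=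
  fun i j hij => hu (k i) (k j) (hk hij)

theorem linearCombination_apply_of_mem (hu : IsSuccessive u) {n p : ℕ+} (hp : p ∈ (u n).support)
    (c : ℕ+ →₀ ℝ) : Finsupp.linearCombination ℝ u c p = c n * u n p := by
  rw [Finsupp.linearCombination_apply, Finsupp.sum, Finsupp.finsetSum_apply]
  rw [Finset.sum_eq_single n]
  · simp
  · intro t _ ht
    have : u t p = 0 := by
      by_contra hne
      exact ht (hu.eq_of_mem (Finsupp.mem_support_iff.2 hne) hp)
    simp [this]
  · intro h
    simp [Finsupp.notMem_support_iff.1 h]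

end IsSuccessive

theorem mem_support_linearCombination {u : ℕ+ → ℕ+ →₀ ℝ} {c : ℕ+ →₀ ℝ} {p : ℕ+}
    (hp : p ∈ (Finsupp.linearCombination ℝ u c).support) :
    ∃ t ∈ c.support, p ∈ (u t).support := by
  rw [Finsupp.linearCombination_apply] at hp
  obtain ⟨t, ht, hpt⟩ := Finset.mem_biUnion.1 (Finsupp.support_finsetSum hp)
  exact ⟨t, ht, Finsupp.support_smul hpt⟩

/-- Blocks of blocks are blocks. -/
theorem IsSuccessive.linearCombination {u c : ℕ+ → ℕ+ →₀ ℝ} (hu : IsSuccessive u)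
    (hc : IsSuccessive c) : IsSuccessive fun n => Finsupp.linearCombination ℝ u (c n) := by
  intro i j hij p hp r hr
  obtain ⟨t, ht, hpt⟩ := mem_support_linearCombination hp
  obtain ⟨t', ht', hrt⟩ := mem_support_linearCombination hr
  exact hu t t' (hc i j hij t ht t' ht') p hpt r hrt

theorem linearCombination_linearCombination (u c : ℕ+ → ℕ+ →₀ ℝ) (b : ℕ+ →₀ ℝ) :
    Finsupp.linearCombination ℝ (fun n => Finsupp.linearCombination ℝ u (c n)) b =
      Finsupp.linearCombination ℝ u (Finsupp.linearCombination ℝ c b) := by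
  rw [Finsupp.linearCombination_apply, Finsupp.linearCombination_apply ℝ b (v := c), Finsupp.sum,
    Finsupp.sum, map_sum]
  exact Finset.sum_congr rfl fun t _ => by rw [map_smul]

theorem linearCombination_nonneg {c : ℕ+ → ℕ+ →₀ ℝ} (hc : ∀ n, 0 ≤ c n) {b : ℕ+ →₀ ℝ}
    (hb : 0 ≤ b) : 0 ≤ Finsupp.linearCombination ℝ c b := by
  rw [Finsupp.linearCombination_apply]
  exact Finset.sum_nonneg fun t _ => smul_nonneg (hb t) (hc t)

/-! ### The norming functionals -/

variable {m n : ℕ+ → ℕ}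

/-- The smallest set of functionals containing `0` and the `± e_i^*`, and closed under the
operations `(g_t)_{t ∈ A} ↦ (1/m_j) ∑_{t ∈ A} g_t`, where `A ∈ S_{n_j}`, the supports of the `g_t`
are successive, and the support of `g_t` lies to the right of `t`. Since the Schreier families are
spreading, the last two conditions say that these supports are `S_{n_j}`-admissible; the index `t`
need not be the minimum of the support. -/
inductive Norming (m n : ℕ+ → ℕ) : (ℕ+ →₀ ℝ) → Prop
  | zero : Norming m n 0
  | single (i : ℕ+) : Norming m n (Finsupp.single i 1)
  | neg_single (i : ℕ+) : Norming m n (Finsupp.single i (-1))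
  | op (j : ℕ+) (A : Finset ℕ+) (g : ℕ+ → ℕ+ →₀ ℝ) (hA : A ∈ schreier (n j))
      (hg : ∀ t ∈ A, Norming m n (g t)) (hle : ∀ t ∈ A, ∀ p ∈ (g t).support, t ≤ p)
      (hlt : ∀ t ∈ A, ∀ t' ∈ A, t < t' → FinsetLT (g t).support (g t').support) :
      Norming m n ((m j : ℝ)⁻¹ • ∑ t ∈ A, g t)

/-- The functionals `∑_{t ∈ A} g_t` over `S_{n_j}`-admissible families of norming functionals;
the norming functionals of weight `m_j` are `1/m_j` times these. -/
def IsLayer (m n : ℕ+ → ℕ) (j : ℕ+) (f : ℕ+ →₀ ℝ) : Prop :=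
  ∃ (A : Finset ℕ+) (g : ℕ+ → ℕ+ →₀ ℝ), A ∈ schreier (n j) ∧ (∀ t ∈ A, Norming m n (g t)) ∧
    (∀ t ∈ A, ∀ p ∈ (g t).support, t ≤ p) ∧
    (∀ t ∈ A, ∀ t' ∈ A, t < t' → FinsetLT (g t).support (g t').support) ∧ f = ∑ t ∈ A, g t

theorem IsLayer.norming {j : ℕ+} {f : ℕ+ →₀ ℝ} (hf : IsLayer m n j f) :
    Norming m n ((m j : ℝ)⁻¹ • f) := by
  obtain ⟨A, g, hA, hg, hle, hlt, rfl⟩ := hf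
  exact Norming.op j A g hA hg hle hlt

theorem Norming.isLayer {f : ℕ+ →₀ ℝ} (hf : Norming m n f) (j : ℕ+) : IsLayer m n j f :=
  ⟨{1}, fun _ => f, singleton_mem_schreier _ 1, fun _ _ => hf, fun t ht p _ => by
    rw [Finset.mem_singleton.1 ht]
    exact one_le, fun t ht t' ht' htt => by
    rw [Finset.mem_singleton.1 ht, Finset.mem_singleton.1 ht'] at htt
    exact absurd htt (lt_irrefl _), by simp⟩

/-- At a point of one of the disjoint supports, the sum takes the value of that summand. -/
theorem sum_apply_of_mem {A : Finset ℕ+} {g : ℕ+ → ℕ+ →₀ ℝ}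
    (hlt : ∀ t ∈ A, ∀ t' ∈ A, t < t' → FinsetLT (g t).support (g t').support) {t p : ℕ+}
    (ht : t ∈ A) (hp : p ∈ (g t).support) : (∑ s ∈ A, g s) p = g t p := by
  rw [Finsupp.finsetSum_apply]
  refine Finset.sum_eq_single t (fun s hs hst => ?_) fun h => absurd ht h
  by_contra hne
  rw [← Ne, ← Finsupp.mem_support_iff] at hne
  rcases lt_or_gt_of_ne hst with h | h
  · exact lt_irrefl _ (hlt s hs t ht h p hne p hp)
  · exact lt_irrefl _ (hlt t ht s hs h p hp p hne)

theorem exists_mem_support_of_sum {A : Finset ℕ+} {g : ℕ+ → ℕ+ →₀ ℝ} {p : ℕ+}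
    (hp : p ∈ (∑ s ∈ A, g s).support) : ∃ t ∈ A, p ∈ (g t).support :=
  Finset.mem_biUnion.1 (Finsupp.support_finsetSum hp)

theorem support_pointwise_smul_subset (h : ℕ+ → ℝ) (f : ℕ+ →₀ ℝ) :
    (h • f).support ⊆ f.support := fun i hi => by
  rw [Finsupp.mem_support_iff] at hi ⊢
  intro h0
  simp [h0] at hi

/-- The norming functionals are stable under changes of signs and restrictions. -/
theorem Norming.pointwise_smul {f : ℕ+ →₀ ℝ} (hf : Norming m n f) {h : ℕ+ → ℝ}
    (hh : ∀ i, h i = 0 ∨ h i = 1 ∨ h i = -1) : Norming m n (h • f) := by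
  have hs : ∀ (i : ℕ+) (r : ℝ), h • Finsupp.single i r = Finsupp.single i (h i * r) := by
    intro i r
    ext p
    by_cases hp : i = p
    · subst hp
      simp
    · simp [hp]
  induction hf with
  | zero =>
    rw [show h • (0 : ℕ+ →₀ ℝ) = 0 by ext; simp]
    exact Norming.zero
  | single i =>
    rw [hs]
    rcases hh i with h | h | h <;> rw [h]
    · simpa using Norming.zero
    · simpa using Norming.single i
    · simpa using Norming.neg_single i
  | neg_single i =>
    rw [hs]
    rcases hh i with h | h | h <;> rw [h]
    · simpa using Norming.zero
    · simpa using Norming.neg_single i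
    · simpa using Norming.single i
  | op j A g hA hg hle hlt ih =>
    have : h • ((m j : ℝ)⁻¹ • ∑ t ∈ A, g t) = (m j : ℝ)⁻¹ • ∑ t ∈ A, h • g t := by
      ext p
      simp only [Finsupp.coe_pointwise_smul, Pi.smul_apply', Finsupp.smul_apply, smul_eq_mul,
        Finsupp.finsetSum_apply, Finset.mul_sum]
      exact Finset.sum_congr rfl fun t _ => by ring
    rw [this]
    exact Norming.op j A _ hA ih
      (fun t ht p hp => hle t ht p (support_pointwise_smul_subset _ _ hp))
      fun t ht t' ht' htt => (hlt t ht t' ht' htt).mono (support_pointwise_smul_subset _ _)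
        (support_pointwise_smul_subset _ _)

theorem IsLayer.pointwise_smul {j : ℕ+} {f : ℕ+ →₀ ℝ} (hf : IsLayer m n j f) {h : ℕ+ → ℝ}
    (hh : ∀ i, h i = 0 ∨ h i = 1 ∨ h i = -1) : IsLayer m n j (h • f) := by
  obtain ⟨A, g, hA, hg, hle, hlt, rfl⟩ := hf
  refine ⟨A, fun t => h • g t, hA, fun t ht => (hg t ht).pointwise_smul hh,
    fun t ht p hp => hle t ht p (support_pointwise_smul_subset _ _ hp),
    fun t ht t' ht' htt => (hlt t ht t' ht' htt).mono (support_pointwise_smul_subset _ _)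
        (support_pointwise_smul_subset _ _), ?_⟩
  ext p
  simp [Finsupp.finsetSum_apply, Finset.mul_sum]

theorem neg_eq_pointwise_smul (f : ℕ+ →₀ ℝ) : -f = (fun _ : ℕ+ => (-1 : ℝ)) • f := by
  ext p
  simp

theorem filter_eq_pointwise_smul (f : ℕ+ →₀ ℝ) (P : ℕ+ → Prop) [DecidablePred P] :
    f.filter P = (fun i => if P i then (1 : ℝ) else 0) • f := by
  ext p
  by_cases hp : P p <;> simp [hp]

theorem indicator_trichotomy (P : ℕ+ → Prop) [DecidablePred P] (i : ℕ+) :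
    (if P i then (1 : ℝ) else 0) = 0 ∨ (if P i then (1 : ℝ) else 0) = 1 ∨
      (if P i then (1 : ℝ) else 0) = -1 := by
  split_ifs <;> simp

theorem Norming.neg {f : ℕ+ →₀ ℝ} (hf : Norming m n f) : Norming m n (-f) := by
  rw [neg_eq_pointwise_smul]
  exact hf.pointwise_smul fun _ => Or.inr (Or.inr rfl)

theorem Norming.filter {f : ℕ+ →₀ ℝ} (hf : Norming m n f) (P : ℕ+ → Prop) [DecidablePred P] :
    Norming m n (f.filter P) := by
  rw [filter_eq_pointwise_smul]
  exact hf.pointwise_smul (indicator_trichotomy P)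

theorem abs_sum_apply_le {A : Finset ℕ+} {g : ℕ+ → ℕ+ →₀ ℝ} {i : ℕ+}
    (hlt : ∀ t ∈ A, ∀ t' ∈ A, t < t' → FinsetLT (g t).support (g t').support)
    (h : ∀ t ∈ A, |g t i| ≤ 1) : |(∑ t ∈ A, g t) i| ≤ 1 := by
  by_cases hi : ∃ t ∈ A, i ∈ (g t).support
  · obtain ⟨t, ht, hit⟩ := hi
    rw [sum_apply_of_mem hlt ht hit]
    exact h t ht
  · push Not at hi
    rw [Finsupp.finsetSum_apply,
      Finset.sum_eq_zero fun t ht => Finsupp.notMem_support_iff.1 (hi t ht)]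
    simp

theorem Norming.abs_apply_le (hm : ∀ j, 1 ≤ m j) {f : ℕ+ →₀ ℝ} (hf : Norming m n f) (i : ℕ+) :
    |f i| ≤ 1 := by
  induction hf with
  | zero => simp
  | single k => by_cases h : k = i <;> simp [h]
  | neg_single k => by_cases h : k = i <;> simp [h]
  | op j A g hA hg hle hlt ih =>
    have hm' : (1 : ℝ) ≤ m j := by exact_mod_cast hm j
    rw [Finsupp.smul_apply, smul_eq_mul, abs_mul, abs_of_nonneg (by positivity)]
    calc (m j : ℝ)⁻¹ * |(∑ t ∈ A, g t) i| ≤ 1 * 1 :=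
          mul_le_mul (inv_le_one_of_one_le₀ hm') (abs_sum_apply_le hlt ih) (abs_nonneg _)
            zero_le_one
      _ = 1 := one_mul 1

theorem IsLayer.abs_apply_le (hm : ∀ j, 1 ≤ m j) {j : ℕ+} {f : ℕ+ →₀ ℝ} (hf : IsLayer m n j f)
    (i : ℕ+) : |f i| ≤ 1 := by
  obtain ⟨A, g, hA, hg, hle, hlt, rfl⟩ := hf
  exact abs_sum_apply_le hlt fun t ht => (hg t ht).abs_apply_le hm i

/-- The norming set of all norming functionals. -/
def normingSet (n : ℕ+ → ℕ) (hm : ∀ j, 1 ≤ m j) : NormingSet where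
  carrier := {f | Norming m n f}
  single_mem := Norming.single
  neg_mem _ hf := Norming.neg hf
  le_one _ hf i := (abs_le.1 (Norming.abs_apply_le hm hf i)).2
  restrict_mem _ hf _ := Norming.filter hf _

/-- The norming set of the sums of `S_{n_j}`-admissible families of norming functionals. -/
def layerSet (n : ℕ+ → ℕ) (hm : ∀ j, 1 ≤ m j) (j : ℕ+) : NormingSet where
  carrier := {f | IsLayer m n j f}
  single_mem i := (Norming.single i).isLayer j
  neg_mem f hf := by
    rw [neg_eq_pointwise_smul]
    exact IsLayer.pointwise_smul hf fun _ => Or.inr (Or.inr rfl)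
  le_one _ hf i := (abs_le.1 (IsLayer.abs_apply_le hm hf i)).2
  restrict_mem f hf k := by
    rw [filter_eq_pointwise_smul]
    exact IsLayer.pointwise_smul hf (indicator_trichotomy _)

end

section

/-! ### The norm of a norming set -/

namespace NormingSet

variable (𝓜 : NormingSet)

theorem pairing_le_norm {μ : ℕ+ →₀ ℝ} (hμ : μ ∈ 𝓜.carrier) (x : ℕ+ →₀ ℝ) :
    pairing x μ ≤ 𝓜.norm x :=
  le_csSup (𝓜.values_bddAbove x) ⟨μ, hμ, rfl⟩

theorem abs_pairing_le_norm {μ : ℕ+ →₀ ℝ} (hμ : μ ∈ 𝓜.carrier) (x : ℕ+ →₀ ℝ) :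
    |pairing x μ| ≤ 𝓜.norm x := by
  refine abs_le'.2 ⟨𝓜.pairing_le_norm hμ x, ?_⟩
  rw [← pairing_neg]
  exact 𝓜.pairing_le_norm (𝓜.neg_mem μ hμ) x

theorem norm_le {x : ℕ+ →₀ ℝ} {r : ℝ} (h : ∀ μ ∈ 𝓜.carrier, pairing x μ ≤ r) :
    𝓜.norm x ≤ r := by
  refine csSup_le (𝓜.values_nonempty x) ?_
  rintro _ ⟨μ, hμ, rfl⟩
  exact h μ hμ

theorem exists_lt_pairing {x : ℕ+ →₀ ℝ} {r : ℝ} (h : r < 𝓜.norm x) :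
    ∃ μ ∈ 𝓜.carrier, r < pairing x μ := by
  obtain ⟨_, ⟨μ, hμ, rfl⟩, h⟩ := exists_lt_of_lt_csSup (𝓜.values_nonempty x) h
  exact ⟨μ, hμ, h⟩

theorem abs_apply_le_norm (x : ℕ+ →₀ ℝ) (i : ℕ+) : |x i| ≤ 𝓜.norm x := by
  have h := 𝓜.abs_pairing_le_norm (𝓜.single_mem i) x
  rwa [pairing_single_right, mul_one] at h

theorem norm_pos {x : ℕ+ →₀ ℝ} (hx : x ≠ 0) : 0 < 𝓜.norm x := by
  obtain ⟨i, hi⟩ := Finsupp.ne_iff.1 hx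
  exact (abs_pos.2 hi).trans_le (𝓜.abs_apply_le_norm x i)

theorem ne_zero_of_norm_eq_one {x : ℕ+ →₀ ℝ} (hx : 𝓜.norm x = 1) : x ≠ 0 := by
  rintro rfl
  simp at hx

end NormingSet

variable {m n : ℕ+ → ℕ}

/-- The norm on `c_00` given by the norming functionals. -/
abbrev tsirelsonNorm (n : ℕ+ → ℕ) (hm : ∀ j, 1 ≤ m j) : Seminorm ℝ (ℕ+ →₀ ℝ) :=
  (normingSet n hm).norm

/-- The norm `sup ∑_t ‖E_t x‖` on `c_00`, the supremum being over the `S_{n_j}`-admissible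
families. -/
abbrev layerNorm (n : ℕ+ → ℕ) (hm : ∀ j, 1 ≤ m j) (j : ℕ+) : Seminorm ℝ (ℕ+ →₀ ℝ) :=
  (layerSet n hm j).norm

variable (hm : ∀ j, 1 ≤ m j)

theorem tsirelsonNorm_pointwise_smul_le (x : ℕ+ →₀ ℝ) {h : ℕ+ → ℝ}
    (hh : ∀ i, h i = 0 ∨ h i = 1 ∨ h i = -1) :
    tsirelsonNorm n hm (h • x) ≤ tsirelsonNorm n hm x := by
  refine NormingSet.norm_le _ fun f hf => ?_
  rw [pairing_smul_pointwise]
  exact NormingSet.pairing_le_norm _ (Norming.pointwise_smul hf hh) x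

theorem tsirelsonNorm_filter_le (x : ℕ+ →₀ ℝ) (P : ℕ+ → Prop) [DecidablePred P] :
    tsirelsonNorm n hm (x.filter P) ≤ tsirelsonNorm n hm x := by
  rw [filter_eq_pointwise_smul]
  exact tsirelsonNorm_pointwise_smul_le hm x (indicator_trichotomy P)

theorem pairing_filter (x f : ℕ+ →₀ ℝ) (P : ℕ+ → Prop) [DecidablePred P] :
    pairing x (f.filter P) = pairing (x.filter P) f := by
  rw [filter_eq_pointwise_smul, filter_eq_pointwise_smul, pairing_smul_pointwise]

theorem layerNorm_le (j : ℕ+) (x : ℕ+ →₀ ℝ) :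
    layerNorm n hm j x ≤ m j * tsirelsonNorm n hm x := by
  refine NormingSet.norm_le _ fun f hf => ?_
  have h := (normingSet n hm).pairing_le_norm (IsLayer.norming hf) x
  have hm' : (0 : ℝ) < m j := by exact_mod_cast hm j
  rw [pairing_smul_right, inv_mul_le_iff₀ hm'] at h
  exact h

theorem tsirelsonNorm_le_layerNorm (j : ℕ+) (x : ℕ+ →₀ ℝ) :
    tsirelsonNorm n hm x ≤ layerNorm n hm j x :=
  NormingSet.norm_le _ fun _ hf => (layerSet n hm j).pairing_le_norm (Norming.isLayer hf j) x

/-- The norms of the restrictions of `x` to an `S_{n_j}`-admissible family add up to at most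
the `j`-th layer norm. -/
theorem sum_tsirelsonNorm_le_layerNorm {j : ℕ+} {A : Finset ℕ+} {y : ℕ+ → ℕ+ →₀ ℝ}
    {x : ℕ+ →₀ ℝ} (hA : A ∈ schreier (n j)) (hle : ∀ t ∈ A, ∀ p ∈ (y t).support, t ≤ p)
    (hlt : ∀ t ∈ A, ∀ t' ∈ A, t < t' → FinsetLT (y t).support (y t').support)
    (hx : ∀ t ∈ A, ∀ p ∈ (y t).support, x p = y t p) :
    ∑ t ∈ A, tsirelsonNorm n hm (y t) ≤ layerNorm n hm j x := by
  refine le_of_forall_pos_le_add fun η hη => ?_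
  have hδ : 0 < η / (A.card + 1) := by positivity
  have hg : ∀ t, ∃ g, Norming m n g ∧ g.support ⊆ (y t).support ∧
      tsirelsonNorm n hm (y t) - η / (A.card + 1) ≤ pairing (y t) g := by
    intro t
    obtain ⟨g, hg, h⟩ := (normingSet n hm).exists_lt_pairing
      (sub_lt_self (tsirelsonNorm n hm (y t)) hδ)
    refine ⟨g.filter (fun p => p ∈ (y t).support), Norming.filter hg _, ?_, ?_⟩
    · intro p hp
      rw [Finsupp.support_filter, Finset.mem_filter] at hp
      exact hp.2
    · rw [pairing_filter, Finsupp.filter_eq_self_iff _ _ |>.2]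
      · exact h.le
      · exact fun p hp => Finsupp.mem_support_iff.2 hp
  choose g hg hsupp hpair using hg
  have hlayer : IsLayer m n j (∑ t ∈ A, g t) :=
    ⟨A, g, hA, fun t _ => hg t, fun t ht p hp => hle t ht p (hsupp t hp),
      fun t ht t' ht' htt => (hlt t ht t' ht' htt).mono (hsupp t) (hsupp t'), rfl⟩
  have h1 := (layerSet n hm j).pairing_le_norm hlayer x
  rw [pairing_sum_right] at h1
  have h2 : ∀ t ∈ A, pairing x (g t) = pairing (y t) (g t) := by
    intro t ht
    rw [pairing_comm x, pairing_comm (y t)]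
    refine Finset.sum_congr rfl fun p hp => ?_
    dsimp only
    rw [hx t ht p (hsupp t hp)]
  rw [Finset.sum_congr rfl h2] at h1
  calc ∑ t ∈ A, tsirelsonNorm n hm (y t)
      ≤ ∑ t ∈ A, (pairing (y t) (g t) + η / (A.card + 1)) :=
        Finset.sum_le_sum fun t _ => by linarith [hpair t]
    _ = ∑ t ∈ A, pairing (y t) (g t) + A.card * (η / (A.card + 1)) := by
        rw [Finset.sum_add_distrib, Finset.sum_const, nsmul_eq_mul]
    _ ≤ layerNorm n hm j x + η := by
        refine add_le_add h1 ?_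
        rw [mul_div_assoc', div_le_iff₀ (by positivity)]
        nlinarith

/-! ### The implicit equation -/

theorem isMixedTsirelsonNorm_tsirelsonNorm : IsMixedTsirelsonNorm m n (tsirelsonNorm n hm) := by
  intro x
  constructor
  · rintro r (⟨i, rfl⟩ | ⟨j, k, E, ⟨hlt, t, ht, hS⟩, rfl⟩)
    · exact NormingSet.abs_apply_le_norm _ x i
    · have htlt : ∀ i i', i < i' → t i < t i' := fun i i' h => hlt i i' h _ (ht i).1 _ (ht i').1
      have htinj : Function.Injective t := StrictMono.injective fun i i' h => htlt i i' h
      let y : ℕ+ → ℕ+ →₀ ℝ := Function.extend t (fun i => x.filter fun p => p ∈ E i) 0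
      have hy : ∀ i, y (t i) = x.filter fun p => p ∈ E i := fun i => htinj.extend_apply _ _ i
      have hysupp : ∀ i, (y (t i)).support ⊆ E i := by
        intro i p hp
        rw [hy, Finsupp.support_filter, Finset.mem_filter] at hp
        exact hp.2
      have h := sum_tsirelsonNorm_le_layerNorm hm (j := j) (y := y) (x := x) hS
        (by
          intro s hs p hp
          obtain ⟨i, -, rfl⟩ := Finset.mem_image.1 hs
          exact (ht i).2 (hysupp i hp))
        (by
          intro s hs s' hs' hss
          obtain ⟨i, -, rfl⟩ := Finset.mem_image.1 hs
          obtain ⟨i', -, rfl⟩ := Finset.mem_image.1 hs'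
          refine (hlt i i' ?_).mono (hysupp i) (hysupp i')
          by_contra hc
          rcases (not_lt.1 hc).lt_or_eq with h | h
          · exact (htlt _ _ h).asymm hss
          · rw [h] at hss
            exact lt_irrefl _ hss)
        (by
          intro s hs p hp
          obtain ⟨i, -, rfl⟩ := Finset.mem_image.1 hs
          have := hysupp i hp
          rw [hy, Finsupp.filter_apply_pos _ _ this])
      rw [Finset.sum_image fun i _ i' _ h => htinj h] at h
      simp only [hy] at h
      have hm' : (0 : ℝ) < m j := by exact_mod_cast hm j
      rw [one_div, inv_mul_le_iff₀ hm']
      exact h.trans (layerNorm_le hm j x)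
  · intro r hr
    have h0 : ∀ i, |x i| ≤ r := fun i => hr (Or.inl ⟨i, rfl⟩)
    refine NormingSet.norm_le _ fun f hf => ?_
    cases hf with
    | zero =>
      rw [pairing_eq_zero (by simp)]
      exact (abs_nonneg _).trans (h0 1)
    | single i =>
      rw [pairing_single_right, mul_one]
      exact (le_abs_self _).trans (h0 i)
    | neg_single i =>
      rw [pairing_single_right, mul_neg_one]
      exact (neg_le_abs _).trans (h0 i)
    | op j A g hA hg hle hlt =>
      have hm' : (0 : ℝ) < m j := by exact_mod_cast hm j
      let B := A.filter fun t => (g t).support.Nonempty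
      have hBA : B ⊆ A := Finset.filter_subset _ _
      have hmin : ∀ t, ∃ s, t ∈ B → IsLeast ((g t).support : Set ℕ+) s := by
        intro t
        by_cases h : (g t).support.Nonempty
        · exact ⟨_, fun _ => Finset.isLeast_min' _ h⟩
        · exact ⟨1, fun ht => absurd (Finset.mem_filter.1 ht).2 h⟩
      choose s hs using hmin
      have hadm : IsAdmissible (n j) fun i => (g (B.orderEmbOfFin rfl i)).support := by
        refine ⟨fun i i' h => hlt _ (hBA (Finset.orderEmbOfFin_mem _ _ _)) _
          (hBA (Finset.orderEmbOfFin_mem _ _ _)) ((B.orderEmbOfFin rfl).strictMono h),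
          fun i => s (B.orderEmbOfFin rfl i), fun i => hs _ (Finset.orderEmbOfFin_mem _ _ _), ?_⟩
        have h1 : Finset.univ.image (fun i => s (B.orderEmbOfFin rfl i)) = B.image s := by
          conv_rhs => rw [← Finset.image_orderEmbOfFin_univ B rfl, Finset.image_image]
          rfl
        rw [h1]
        exact image_mem_schreier (τ := id) hA (fun l hl => hBA hl)
          (fun l hl => hle l (hBA hl) _ (hs l hl).1) (fun _ _ _ _ h => h)
          fun l hl l' hl' h => hlt l (hBA hl) l' (hBA hl') h _ (hs l hl).1 _ (hs l' hl').1
      have h1 := hr (Or.inr ⟨j, _, _, hadm, rfl⟩)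
      refine le_trans ?_ h1
      rw [pairing_smul_right, pairing_sum_right, one_div]
      have h2 : ∑ i, tsirelsonNorm n hm
          (x.filter fun p => p ∈ (g (B.orderEmbOfFin rfl i)).support) =
          ∑ t ∈ B, tsirelsonNorm n hm (x.filter fun p => p ∈ (g t).support) := by
        conv_rhs => rw [← Finset.image_orderEmbOfFin_univ B rfl]
        rw [Finset.sum_image fun i _ i' _ h => (B.orderEmbOfFin rfl).injective h]
      rw [h2]
      gcongr
      rw [← Finset.sum_subset hBA]
      · refine Finset.sum_le_sum fun t ht => ?_
        have h3 : (g t).filter (fun p => p ∈ (g t).support) = g t :=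
          (Finsupp.filter_eq_self_iff _ _).2 fun p hp => Finsupp.mem_support_iff.2 hp
        rw [← h3, pairing_filter, h3]
        exact NormingSet.pairing_le_norm _ (hg t (hBA ht)) _
      · intro t ht htB
        refine pairing_eq_zero fun p hp => ?_
        exact absurd (Finset.mem_filter.2 ⟨ht, p, hp⟩) htB

/-- One inequality between two solutions of the implicit equation that agree on vectors of
smaller support. -/
theorem IsMixedTsirelsonNorm.le_of_agree (hm2 : ∀ j, 2 ≤ m j) {q q' : Seminorm ℝ (ℕ+ →₀ ℝ)}
    (hq : IsMixedTsirelsonNorm m n q) (hq' : IsMixedTsirelsonNorm m n q') {x : ℕ+ →₀ ℝ}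
    (h : ∀ y : ℕ+ →₀ ℝ, y.support.card < x.support.card → q y = q' y) : q x ≤ q' x := by
  have hub : q x ≤ max (q' x) (q x / 2) := by
    refine (hq x).2 ?_
    rintro r (⟨i, rfl⟩ | ⟨j, k, E, hE, rfl⟩)
    · exact ((hq' x).1 (Or.inl ⟨i, rfl⟩)).trans (le_max_left _ _)
    · by_cases hcard : ∀ i, (x.filter fun p => p ∈ E i).support.card < x.support.card
      · rw [Finset.sum_congr rfl fun i _ => h _ (hcard i)]
        exact ((hq' x).1 (Or.inr ⟨j, k, E, hE, rfl⟩)).trans (le_max_left _ _)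
      · push Not at hcard
        obtain ⟨i, hi⟩ := hcard
        have hsub : ∀ p ∈ x.support, p ∈ E i := by
          rw [Finsupp.support_filter] at hi
          exact Finset.card_filter_eq_iff.1 (le_antisymm (Finset.card_filter_le _ _) hi)
        have hsum : ∑ i, q (x.filter fun p => p ∈ E i) = q x := by
          rw [Finset.sum_eq_single i]
          · rw [(Finsupp.filter_eq_self_iff _ _).2 fun p hp =>
              hsub p (Finsupp.mem_support_iff.2 hp)]
          · intro i' _ hne
            have : x.filter (fun p => p ∈ E i') = 0 := by
              refine (Finsupp.filter_eq_zero_iff _ _).2 fun p hp => ?_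
              by_contra hxp
              have hpi := hsub p (Finsupp.mem_support_iff.2 hxp)
              rcases lt_or_gt_of_ne hne with h' | h'
              · exact lt_irrefl _ (hE.1 i' i h' p hp p hpi)
              · exact lt_irrefl _ (hE.1 i i' h' p hpi p hp)
            rw [this, map_zero]
          · exact fun h => absurd (Finset.mem_univ i) h
        rw [hsum]
        refine le_trans ?_ (le_max_right _ _)
        have hmj : (2 : ℝ) ≤ m j := by exact_mod_cast hm2 j
        rw [one_div_mul_eq_div]
        exact div_le_div_of_nonneg_left (apply_nonneg q x) two_pos hmj
  rcases le_max_iff.1 hub with h1 | h1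
  · exact h1
  · have h2 := apply_nonneg q' x
    linarith

/-- The implicit equation has at most one solution. -/
theorem IsMixedTsirelsonNorm.unique (hm2 : ∀ j, 2 ≤ m j) {q q' : Seminorm ℝ (ℕ+ →₀ ℝ)}
    (hq : IsMixedTsirelsonNorm m n q) (hq' : IsMixedTsirelsonNorm m n q') : q = q' := by
  ext x
  induction h : x.support.card using Nat.strong_induction_on generalizing x with
  | _ k ih =>
    subst h
    exact le_antisymm (hq.le_of_agree hm2 hq' fun y hy => ih _ hy y rfl)
      (hq'.le_of_agree hm2 hq fun y hy => (ih _ hy y rfl).symm)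

theorem mixedTsirelsonNorm_eq (hm2 : ∀ j, 2 ≤ m j) :
    mixedTsirelsonNorm m n = tsirelsonNorm n hm := by
  have h : {q | IsMixedTsirelsonNorm m n q} = {tsirelsonNorm n hm} :=
    Set.eq_singleton_iff_unique_mem.2 ⟨isMixedTsirelsonNorm_tsirelsonNorm hm, fun q hq =>
      IsMixedTsirelsonNorm.unique hm2 hq (isMixedTsirelsonNorm_tsirelsonNorm hm)⟩
  rw [mixedTsirelsonNorm, h]
  exact csSup_singleton (tsirelsonNorm n hm)

end

section

variable {m n : ℕ+ → ℕ}

/-! ### Norms of block vectors -/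

section Blocks

variable (hm : ∀ j, 1 ≤ m j) {u : ℕ+ → ℕ+ →₀ ℝ}

theorem IsSuccessive.filter_linearCombination (hu : IsSuccessive u) (c : ℕ+ →₀ ℝ) (t : ℕ+) :
    (Finsupp.linearCombination ℝ u c).filter (fun p => p ∈ (u t).support) = c t • u t := by
  ext p
  by_cases hp : p ∈ (u t).support
  · rw [Finsupp.filter_apply_pos _ _ hp, hu.linearCombination_apply_of_mem hp]
    simp
  · rw [Finsupp.filter_apply_neg _ _ hp, Finsupp.smul_apply, Finsupp.notMem_support_iff.1 hp,
      smul_zero]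

theorem IsSuccessive.abs_mul_norm_le (hu : IsSuccessive u) (c : ℕ+ →₀ ℝ) (t : ℕ+) :
    |c t| * tsirelsonNorm n hm (u t) ≤
      tsirelsonNorm n hm (Finsupp.linearCombination ℝ u c) := by
  have h := tsirelsonNorm_filter_le (n := n) hm (Finsupp.linearCombination ℝ u c)
    (fun p => p ∈ (u t).support)
  rwa [hu.filter_linearCombination, map_smul_eq_mul, Real.norm_eq_abs] at h

theorem norm_linearCombination_le (q : Seminorm ℝ (ℕ+ →₀ ℝ)) {u : ℕ+ → ℕ+ →₀ ℝ}
    (hu : ∀ t, q (u t) ≤ 1) {c : ℕ+ →₀ ℝ} (hc : 0 ≤ c) :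
    q (Finsupp.linearCombination ℝ u c) ≤ coeffSum c := by
  rw [Finsupp.linearCombination_apply, Finsupp.sum, coeffSum_apply]
  refine (Finset.le_sum_of_subadditive q (map_zero q).le (map_add_le_add q) _ _).trans (Finset.sum_le_sum fun t _ => ?_)
  rw [map_smul_eq_mul, Real.norm_of_nonneg (hc t)]
  exact mul_le_of_le_one_right (hc t) (hu t)

theorem IsSuccessive.sum_abs_le_layerNorm (hu : IsSuccessive u)
    (hu1 : ∀ t, tsirelsonNorm n hm (u t) = 1) {j : ℕ+} {c : ℕ+ →₀ ℝ}
    (hc : c.support ∈ schreier (n j)) :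
    ∑ t ∈ c.support, |c t| ≤ layerNorm n hm j (Finsupp.linearCombination ℝ u c) := by
  have h0 : ∀ t, u t ≠ 0 := fun t => NormingSet.ne_zero_of_norm_eq_one _ (hu1 t)
  have h := sum_tsirelsonNorm_le_layerNorm hm (y := fun t => c t • u t)
    (x := Finsupp.linearCombination ℝ u c) hc
    (fun t _ p hp => hu.le_of_mem h0 (Finsupp.support_smul hp))
    (fun t _ t' _ htt => (hu t t' htt).mono Finsupp.support_smul Finsupp.support_smul)
    (fun t _ p hp => by
      rw [hu.linearCombination_apply_of_mem (Finsupp.support_smul hp)]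
      simp)
  refine le_of_eq_of_le (Finset.sum_congr rfl fun t _ => ?_) h
  rw [map_smul_eq_mul, hu1, mul_one, Real.norm_eq_abs]

/-- The lower `ℓ₁` estimate over Schreier sets. -/
theorem IsSuccessive.sum_abs_le (hu : IsSuccessive u)
    (hu1 : ∀ t, tsirelsonNorm n hm (u t) = 1) {j : ℕ+} {c : ℕ+ →₀ ℝ}
    (hc : c.support ∈ schreier (n j)) :
    ∑ t ∈ c.support, |c t| ≤ m j * tsirelsonNorm n hm (Finsupp.linearCombination ℝ u c) :=
  (hu.sum_abs_le_layerNorm hm hu1 hc).trans (layerNorm_le hm j _)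

end Blocks

/-! ### Averages against functionals of small weight -/

/-- The supports of the functional `f` and of the vector `x` meet. -/
def Meets (f x : ℕ+ →₀ ℝ) : Prop := ∃ p ∈ f.support, p ∈ x.support

theorem pairing_eq_zero_of_not_meets {f x : ℕ+ →₀ ℝ} (h : ¬ Meets f x) : pairing x f = 0 :=
  pairing_eq_zero fun p hp hpx => h ⟨p, hp, hpx⟩

/-- If at most one member of a successive family of functionals meets `x`, then their sum acts
on `x` as `0` or as that member. -/
theorem pairing_sum_of_not_split {A : Finset ℕ+} {g : ℕ+ → ℕ+ →₀ ℝ} {x : ℕ+ →₀ ℝ}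
    (h : ∀ t ∈ A, ∀ t' ∈ A, t < t' → Meets (g t) x → ¬ Meets (g t') x) :
    pairing x (∑ t ∈ A, g t) = 0 ∨
      ∃ t ∈ A, Meets (g t) x ∧ pairing x (∑ t ∈ A, g t) = pairing x (g t) := by
  rw [pairing_sum_right]
  by_cases hex : ∃ t ∈ A, Meets (g t) x
  · obtain ⟨t, ht, hmt⟩ := hex
    refine Or.inr ⟨t, ht, hmt, Finset.sum_eq_single t (fun s hs hst => ?_) fun h => absurd ht h⟩
    refine pairing_eq_zero_of_not_meets fun hms => ?_
    rcases lt_or_gt_of_ne hst with h' | h'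
    · exact h s hs t ht h' hms hmt
    · exact h t ht s hs h' hmt hms
  · push Not at hex
    exact Or.inl (Finset.sum_eq_zero fun t ht => pairing_eq_zero_of_not_meets (hex t ht))

/-- A functional of weight `m_r` is at most about `1/m_r` on an average of unit vectors whose
coefficients are small on `S_{n_r}`: the vectors met by two members of the admissible family form,
up to spreading, a set in `S_{n_r}`, and on the others at most one member acts. -/
theorem abs_pairing_average_le (hm : ∀ j, 1 ≤ m j) {r : ℕ+} {u : ℕ+ → ℕ+ →₀ ℝ}
    (hu : IsSuccessive u) (hu1 : ∀ t, tsirelsonNorm n hm (u t) = 1) {b : ℕ+ →₀ ℝ} (hb : 0 ≤ b)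
    (hb1 : coeffSum b = 1) {ε : ℝ} (hsmall : IsSmallOn (lastPoint u) (n r) ε b) {f : ℕ+ →₀ ℝ}
    (hf : IsLayer m n r f) :
    |pairing (Finsupp.linearCombination ℝ u b) f| ≤ 1 + m r * ε := by
  classical
  have h0 : ∀ t, u t ≠ 0 := fun t => NormingSet.ne_zero_of_norm_eq_one _ (hu1 t)
  have hall : ∀ l, |pairing (u l) f| ≤ m r := by
    intro l
    have h := ((layerSet n hm r).abs_pairing_le_norm hf (u l)).trans (layerNorm_le hm r (u l))
    rwa [hu1, mul_one] at h
  obtain ⟨A, g, hA, hg, hle, hlt, rfl⟩ := hf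
  let L := b.support.filter fun l => ∃ t ∈ A, ∃ t' ∈ A, t < t' ∧ Meets (g t) (u l) ∧
    Meets (g t') (u l)
  have hL : L.image (lastPoint u) ∈ schreier (n r) := by
    have hτ : ∀ l, ∃ t', l ∈ L → t' ∈ A ∧ Meets (g t') (u l) ∧
        ∃ t ∈ A, t < t' ∧ Meets (g t) (u l) := by
      intro l
      by_cases hl : l ∈ L
      · obtain ⟨-, t, ht, t', ht', htt, h1, h2⟩ := Finset.mem_filter.1 hl
        exact ⟨t', fun _ => ⟨ht', h2, t, ht, htt, h1⟩⟩
      · exact ⟨1, fun h => absurd h hl⟩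
    choose τ hτ using hτ
    refine image_mem_schreier (τ := τ) hA (fun l hl => (hτ l hl).1) ?_ ?_
      fun l _ l' _ h => hu.strictMono_lastPoint h0 h
    · intro l hl
      obtain ⟨h1, ⟨p, hp, hpu⟩, -⟩ := hτ l hl
      exact (hle _ h1 p hp).trans (le_lastPoint hpu)
    · intro l hl l' hl' hll
      obtain ⟨h1, ⟨p, hp, hpu⟩, -⟩ := hτ l hl
      obtain ⟨h2, -, t, ht, htt, ⟨p', hp', hpu'⟩⟩ := hτ l' hl'
      refine lt_of_not_ge fun hc => ?_
      exact (hu l l' hll p hpu p' hpu').asymm (hlt t ht _ h1 (htt.trans_le hc) p' hp' p hp)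
  have hrest : ∀ l ∈ b.support, l ∉ L → |pairing (u l) (∑ t ∈ A, g t)| ≤ 1 := by
    intro l hl hlL
    rcases pairing_sum_of_not_split (A := A) (g := g) (x := u l) (fun t ht t' ht' htt h1 h2 =>
      hlL (Finset.mem_filter.2 ⟨hl, t, ht, t', ht', htt, h1, h2⟩)) with h | ⟨t, ht, -, h⟩
    · rw [h]
      simp
    · rw [h, ← hu1 l]
      exact (normingSet n hm).abs_pairing_le_norm (hg t ht) (u l)
  rw [pairing_linearCombination]
  refine (Finset.abs_sum_le_sum_abs _ _).trans ?_
  have hterm : ∀ l ∈ b.support, |b l * pairing (u l) (∑ t ∈ A, g t)| ≤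
      b l + (if l ∈ L then m r * b l else 0) := by
    intro l hl
    rw [abs_mul, abs_of_nonneg (hb l)]
    have hbl : 0 ≤ b l := hb l
    split_ifs with h
    · nlinarith [hall l]
    · nlinarith [hrest l hl h]
  refine (Finset.sum_le_sum hterm).trans ?_
  rw [Finset.sum_add_distrib, ← coeffSum_apply, hb1, ← Finset.sum_filter,
    Finset.filter_mem_eq_inter, Finset.inter_eq_right.2 (Finset.filter_subset _ _),
    ← Finset.mul_sum]
  gcongr
  exact hsmall L hL

/-! ### Rapidly increasing sequences -/

/-- Every functional of weight `m_r`, `r ≥ j`, is at most `3/m_j` on all members of the sequence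
`v` but one. -/
def IsRapid (m n : ℕ+ → ℕ) (j : ℕ+) (v : ℕ+ → ℕ+ →₀ ℝ) : Prop :=
  ∀ r, j ≤ r → ∀ f, IsLayer m n r f →
    ∃ k₀, ∀ k, k ≠ k₀ → |pairing (v k) ((m r : ℝ)⁻¹ • f)| ≤ 3 / m j

theorem IsRapid.comp {j : ℕ+} {v : ℕ+ → ℕ+ →₀ ℝ} (hv : IsRapid m n j v) {k : ℕ+ → ℕ+}
    (hk : StrictMono k) : IsRapid m n j (v ∘ k) := by
  intro r hr f hf
  obtain ⟨k₀, h⟩ := hv r hr f hf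
  by_cases hex : ∃ i, k i = k₀
  · obtain ⟨i₀, rfl⟩ := hex
    exact ⟨i₀, fun i hi => h (k i) (hk.injective.ne hi)⟩
  · push Not at hex
    exact ⟨1, fun i _ => h (k i) (hex i)⟩

/-- The set `G` separates two points of the support of `x`. -/
def IsCut (G : Finset ℕ+) (x : ℕ+ →₀ ℝ) : Prop :=
  ∃ a ∈ x.support, ∃ p ∈ x.support, ∃ g ∈ G, a < g ∧ g ≤ p

theorem IsCut.mono {G G' : Finset ℕ+} {x : ℕ+ →₀ ℝ} (h : IsCut G x) (hG : G ⊆ G') :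
    IsCut G' x := by
  obtain ⟨a, ha, p, hp, g, hg, h⟩ := h
  exact ⟨a, ha, p, hp, g, hG hg, h⟩

theorem exists_min_of_support (ξ : ℕ) (f : ℕ+ →₀ ℝ) :
    ∃ G ∈ schreier ξ, G ⊆ f.support ∧ ∀ p ∈ f.support, ∃ g ∈ G, g ≤ p := by
  rcases f.support.eq_empty_or_nonempty with h | h
  · exact ⟨∅, empty_mem_schreier ξ, by simp, by simp [h]⟩
  · exact ⟨{f.support.min' h}, singleton_mem_schreier ξ _,
      Finset.singleton_subset_iff.2 (Finset.min'_mem _ _), fun p hp =>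
      ⟨_, Finset.mem_singleton_self _, Finset.min'_le _ p hp⟩⟩

/-- Decompose a norming functional into the tree of the operations that build it, and stop on each
branch at a weight with index `≥ j` or as soon as the product of the weights reaches `m_j ^ 3`.
`D` is the product of the weights already passed, and `ξ` bounds the order of the Schreier families
that can still occur before stopping.  Let `G` be the set of the minima of the supports of the
functionals reached at the end.  A member of a rapidly increasing sequence that is not cut by `G` is
seen by one branch only, and is therefore small, unless it belongs to the set `C` of the
exceptional vectors of the final functionals, of which there is at most one for each. -/
theorem exists_exceptional_sets (hm : ∀ j, 1 ≤ m j) (hmono : StrictMono m) {j : ℕ+}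
    {v : ℕ+ → ℕ+ →₀ ℝ} (hv : IsSuccessive v) (hv1 : ∀ k, tsirelsonNorm n hm (v k) = 1)
    (hrap : IsRapid m n j v) {f : ℕ+ →₀ ℝ} (hf : Norming m n f) : ∀ D ξ : ℕ,
    (∀ ρ : ℕ+ → ℕ, D * ∏ i ∈ Finset.Ico 1 j, m i ^ ρ i < m j ^ 3 →
      ∑ i ∈ Finset.Ico 1 j, ρ i * n i ≤ ξ) →
    ∃ G C : Finset ℕ+, G ∈ schreier ξ ∧ C.image (lastPoint v) ∈ schreier ξ ∧ G ⊆ f.support ∧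
      (∀ p ∈ f.support, ∃ g ∈ G, g ≤ p) ∧ (∀ k ∈ C, Meets f (v k)) ∧
      ∀ k, k ∉ C → ¬ IsCut G (v k) → |pairing (v k) f| ≤ 3 / m j + D / (m j : ℝ) ^ 2 := by
  classical
  have h0 : ∀ k, v k ≠ 0 := fun k => NormingSet.ne_zero_of_norm_eq_one _ (hv1 k)
  have hmj : ∀ j, (0 : ℝ) < m j := fun j => by exact_mod_cast hm j
  have hbound : ∀ D : ℕ, (0 : ℝ) ≤ 3 / m j + D / (m j : ℝ) ^ 2 := fun D => by
    have := hmj j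
    positivity
  have hcoord : ∀ (i : ℕ+) (s : ℝ) (D ξ : ℕ), ∃ G C : Finset ℕ+, G ∈ schreier ξ ∧
      C.image (lastPoint v) ∈ schreier ξ ∧ G ⊆ (Finsupp.single i s).support ∧
      (∀ p ∈ (Finsupp.single i s).support, ∃ g ∈ G, g ≤ p) ∧
      (∀ k ∈ C, Meets (Finsupp.single i s) (v k)) ∧ ∀ k, k ∉ C → ¬ IsCut G (v k) →
        |pairing (v k) (Finsupp.single i s)| ≤ 3 / m j + D / (m j : ℝ) ^ 2 := by
    intro i s D ξ
    obtain ⟨G, hG, h1, h2⟩ := exists_min_of_support ξ (Finsupp.single i s)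
    by_cases hex : ∃ k, Meets (Finsupp.single i s) (v k)
    · obtain ⟨k₀, hk₀⟩ := hex
      refine ⟨G, {k₀}, hG, by simpa using singleton_mem_schreier ξ _, h1, h2, by simpa using hk₀,
        fun k hk _ => ?_⟩
      rw [pairing_eq_zero_of_not_meets, abs_zero]
      · exact hbound D
      · rintro ⟨p, hp, hpv⟩
        obtain ⟨p₀, hp₀, hpv₀⟩ := hk₀
        have hpi := Finset.mem_singleton.1 (Finsupp.support_single_subset hp)
        have hpi₀ := Finset.mem_singleton.1 (Finsupp.support_single_subset hp₀)
        rw [hpi] at hpv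
        rw [hpi₀] at hpv₀
        exact hk (Finset.mem_singleton.2 (hv.eq_of_mem hpv hpv₀))
    · push Not at hex
      refine ⟨G, ∅, hG, by simpa using empty_mem_schreier ξ, h1, h2, by simp, fun k _ _ => ?_⟩
      rw [pairing_eq_zero_of_not_meets (hex k), abs_zero]
      exact hbound D
  induction hf with
  | zero =>
    intro D ξ _
    refine ⟨∅, ∅, empty_mem_schreier ξ, by simpa using empty_mem_schreier ξ, by simp, by simp,
      by simp, fun k _ _ => ?_⟩
    rw [pairing_eq_zero (by simp), abs_zero]
    exact hbound D
  | single i => exact fun D ξ _ => hcoord i 1 D ξ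
  | neg_single i => exact fun D ξ _ => hcoord i (-1) D ξ
  | op r A g hA hg hle hlt ih =>
    intro D ξ hbud
    have hlayer : IsLayer m n r (∑ t ∈ A, g t) := ⟨A, g, hA, hg, hle, hlt, rfl⟩
    have hnorming := hlayer.norming
    have hone : ∀ k, |pairing (v k) ((m r : ℝ)⁻¹ • ∑ t ∈ A, g t)| ≤ 1 := fun k => by
      rw [← hv1 k]
      exact (normingSet n hm).abs_pairing_le_norm hnorming (v k)
    rcases le_or_gt j r with hjr | hrj
    · -- The weight is at least `m_j`: stop, with at most one exceptional vector.
      obtain ⟨k₀, hk₀⟩ := hrap r hjr _ hlayer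
      obtain ⟨G, hG, h1, h2⟩ := exists_min_of_support ξ ((m r : ℝ)⁻¹ • ∑ t ∈ A, g t)
      have hadd : (3 : ℝ) / m j ≤ 3 / m j + D / (m j : ℝ) ^ 2 :=
        le_add_of_nonneg_right (by positivity)
      by_cases hmeet : Meets ((m r : ℝ)⁻¹ • ∑ t ∈ A, g t) (v k₀)
      · refine ⟨G, {k₀}, hG, by simpa using singleton_mem_schreier ξ _, h1, h2, by simpa using hmeet,
          fun k hk _ => (hk₀ k fun h => hk (Finset.mem_singleton.2 h)).trans hadd⟩
      · refine ⟨G, ∅, hG, by simpa using empty_mem_schreier ξ, h1, h2, by simp, fun k _ _ => ?_⟩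
        by_cases hk : k = k₀
        · rw [hk, pairing_eq_zero_of_not_meets hmeet, abs_zero]
          exact hbound D
        · exact (hk₀ k hk).trans hadd
    · rcases le_or_gt (m j ^ 3) (D * m r) with hover | hunder
      · -- The product of the weights reaches `m_j ^ 3`: stop, the previous product being large.
        obtain ⟨G, hG, h1, h2⟩ := exists_min_of_support ξ ((m r : ℝ)⁻¹ • ∑ t ∈ A, g t)
        refine ⟨G, ∅, hG, by simpa using empty_mem_schreier ξ, h1, h2, by simp,
          fun k _ _ => (hone k).trans ?_⟩
        have hD : m j ^ 2 ≤ D := by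
          have h3 : m j ^ 2 * m j ≤ D * m j := by
            calc m j ^ 2 * m j = m j ^ 3 := by ring
              _ ≤ D * m r := hover
              _ ≤ D * m j := Nat.mul_le_mul_left D (hmono hrj).le
          exact Nat.le_of_mul_le_mul_right h3 (hm j)
        have hD' : (m j : ℝ) ^ 2 ≤ D := by exact_mod_cast hD
        have h4 : (1 : ℝ) ≤ D / (m j : ℝ) ^ 2 := by
          rw [le_div_iff₀ (pow_pos (hmj j) 2), one_mul]
          exact hD'
        have h5 : (0 : ℝ) ≤ 3 / m j := by positivity
        linarith
      · have hrI : r ∈ Finset.Ico 1 j := Finset.mem_Ico.2 ⟨one_le, hrj⟩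
        have hbud' : ∀ ρ : ℕ+ → ℕ, (D * m r) * ∏ i ∈ Finset.Ico 1 j, m i ^ ρ i < m j ^ 3 →
            n r + ∑ i ∈ Finset.Ico 1 j, ρ i * n i ≤ ξ := by
          intro ρ hρ
          have h := hbud (fun i => (if r = i then 1 else 0) + ρ i)
          simp only [pow_add, add_mul, Finset.prod_mul_distrib, Finset.sum_add_distrib,
            Finset.prod_pow_boole, Finset.sum_boole_mul, if_pos hrI] at h
          exact h (by rwa [← mul_assoc])
        have hnr : n r ≤ ξ := by
          have h := hbud' 0 (by simpa using hunder)
          simpa using h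
        have hih : ∀ t, ∃ G C : Finset ℕ+, t ∈ A → G ∈ schreier (ξ - n r) ∧
            C.image (lastPoint v) ∈ schreier (ξ - n r) ∧ G ⊆ (g t).support ∧
            (∀ p ∈ (g t).support, ∃ a ∈ G, a ≤ p) ∧ (∀ k ∈ C, Meets (g t) (v k)) ∧
            ∀ k, k ∉ C → ¬ IsCut G (v k) →
              |pairing (v k) (g t)| ≤ 3 / m j + (D * m r : ℕ) / (m j : ℝ) ^ 2 := by
          intro t
          by_cases ht : t ∈ A
          · obtain ⟨G, C, h⟩ := ih t ht (D * m r) (ξ - n r) fun ρ hρ =>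
              Nat.le_sub_of_add_le (by rw [add_comm]; exact hbud' ρ hρ)
            exact ⟨G, C, fun _ => h⟩
          · exact ⟨∅, ∅, fun h => absurd h ht⟩
        choose G C hGC using hih
        have hξ : n r + (ξ - n r) = ξ := Nat.add_sub_of_le hnr
        have hr0 : (m r : ℝ)⁻¹ ≠ 0 := inv_ne_zero (hmj r).ne'
        have hsupp : ((m r : ℝ)⁻¹ • ∑ t ∈ A, g t).support = (∑ t ∈ A, g t).support :=
          Finsupp.support_smul_eq hr0
        have hcut : ∀ k, ∀ t ∈ A, ∀ t' ∈ A, t < t' → Meets (g t) (v k) → Meets (g t') (v k) →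
            IsCut (A.biUnion G) (v k) := by
          rintro k t ht t' ht' htt ⟨p, hp, hpv⟩ ⟨p', hp', hpv'⟩
          obtain ⟨a, ha, hap⟩ := (hGC t' ht').2.2.2.1 p' hp'
          exact ⟨p, hpv, p', hpv', a, Finset.mem_biUnion.2 ⟨t', ht', ha⟩,
            hlt t ht t' ht' htt p hp a ((hGC t' ht').2.2.1 ha), hap⟩
        refine ⟨A.biUnion G, (A.biUnion C).filter fun k => ¬ IsCut (A.biUnion G) (v k),
          ?_, ?_, ?_, ?_, ?_, ?_⟩
        · have h := biUnion_mem_schreier hA (fun t ht => (hGC t ht).1)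
            (fun t ht p hp => hle t ht p ((hGC t ht).2.2.1 hp))
            (fun t ht t' ht' htt =>
              (hlt t ht t' ht' htt).mono (hGC t ht).2.2.1 (hGC t' ht').2.2.1)
          rwa [hξ] at h
        · have h := biUnion_mem_schreier (b := ξ - n r)
            (H := fun t => ((C t).filter fun k => ¬ IsCut (A.biUnion G) (v k)).image (lastPoint v))
            hA
            (fun t ht => schreier_hereditary (hGC t ht).2.1
              (Finset.image_subset_image (Finset.filter_subset _ _)))
            (fun t ht p hp => by
              obtain ⟨k, hk, rfl⟩ := Finset.mem_image.1 hp
              obtain ⟨p, hp, hpv⟩ := (hGC t ht).2.2.2.2.1 k (Finset.mem_filter.1 hk).1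
              exact (hle t ht p hp).trans (le_lastPoint hpv))
            (fun t ht t' ht' htt p hp p' hp' => by
              obtain ⟨k, hk, rfl⟩ := Finset.mem_image.1 hp
              obtain ⟨k', hk', rfl⟩ := Finset.mem_image.1 hp'
              rw [Finset.mem_filter] at hk hk'
              have hmk := (hGC t ht).2.2.2.2.1 k hk.1
              have hmk' := (hGC t' ht').2.2.2.2.1 k' hk'.1
              refine hv.strictMono_lastPoint h0 (lt_of_le_of_ne ?_ ?_)
              · obtain ⟨p, hp, hpv⟩ := hmk
                obtain ⟨p', hp', hpv'⟩ := hmk'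
                exact hv.le_of_lt hpv hpv' (hlt t ht t' ht' htt p hp p' hp')
              · rintro rfl
                exact hk.2 (hcut k t ht t' ht' htt hmk hmk'))
          rw [hξ] at h
          rw [Finset.filter_biUnion, Finset.biUnion_image]
          exact h
        · intro p hp
          obtain ⟨t, ht, hpt⟩ := Finset.mem_biUnion.1 hp
          have hpt' := (hGC t ht).2.2.1 hpt
          rw [hsupp, Finsupp.mem_support_iff, sum_apply_of_mem hlt ht hpt']
          exact Finsupp.mem_support_iff.1 hpt'
        · intro p hp
          rw [hsupp] at hp
          obtain ⟨t, ht, hpt⟩ := exists_mem_support_of_sum hp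
          obtain ⟨a, ha, hap⟩ := (hGC t ht).2.2.2.1 p hpt
          exact ⟨a, Finset.mem_biUnion.2 ⟨t, ht, ha⟩, hap⟩
        · intro k hk
          obtain ⟨t, ht, hkt⟩ := Finset.mem_biUnion.1 (Finset.mem_filter.1 hk).1
          obtain ⟨p, hp, hpv⟩ := (hGC t ht).2.2.2.2.1 k hkt
          refine ⟨p, ?_, hpv⟩
          rw [hsupp, Finsupp.mem_support_iff, sum_apply_of_mem hlt ht hp]
          exact Finsupp.mem_support_iff.1 hp
        · intro k hk hkG
          rw [pairing_smul_right, abs_mul, abs_of_nonneg (inv_nonneg.2 (hmj r).le)]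
          rcases pairing_sum_of_not_split (A := A) (g := g) (x := v k)
            (fun t ht t' ht' htt h1 h2 => hkG (hcut k t ht t' ht' htt h1 h2)) with
            h | ⟨t, ht, -, h⟩
          · rw [h, abs_zero, mul_zero]
            exact hbound D
          · rw [h]
            have hkt : |pairing (v k) (g t)| ≤ 3 / m j + (D * m r : ℕ) / (m j : ℝ) ^ 2 := by
              refine (hGC t ht).2.2.2.2.2 k (fun hkC => hk ?_) fun hc =>
                hkG (hc.mono (Finset.subset_biUnion_of_mem G ht))
              exact Finset.mem_filter.2 ⟨Finset.mem_biUnion.2 ⟨t, ht, hkC⟩, hkG⟩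
            have hr1 : (1 : ℝ) ≤ m r := by exact_mod_cast hm r
            calc (m r : ℝ)⁻¹ * |pairing (v k) (g t)|
                ≤ (m r : ℝ)⁻¹ * (3 / m j + (D * m r : ℕ) / (m j : ℝ) ^ 2) := by gcongr
              _ = (m r : ℝ)⁻¹ * (3 / m j) + D / (m j : ℝ) ^ 2 := by
                  have := (hmj r).ne'
                  push_cast
                  field_simp
              _ ≤ 3 / m j + D / (m j : ℝ) ^ 2 := by
                  gcongr
                  exact mul_le_of_le_one_left (by positivity) (inv_le_one_of_one_le₀ hr1)

end

section

variable {m l n : ℕ+ → ℕ}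

/-! ### The sequence `f_j` -/

theorem sum_le_fSeq (hm2 : ∀ i, 2 ≤ m i) {j : ℕ+} {ρ : ℕ+ → ℕ}
    (h : ∏ i ∈ Finset.Ico 1 j, m i ^ ρ i < m j ^ 3) :
    ∑ i ∈ Finset.Ico 1 j, ρ i * n i ≤ fSeq m n j := by
  unfold fSeq
  split_ifs with hj
  · subst hj
    simp
  · refine le_csSup ⟨∑ i ∈ Finset.Ico 1 j, m j ^ 3 * n i, ?_⟩ ⟨ρ, h, rfl⟩
    rintro _ ⟨σ, hσ, rfl⟩
    refine Finset.sum_le_sum fun i hi => Nat.mul_le_mul_right _ ?_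
    calc σ i ≤ 2 ^ σ i := Nat.lt_two_pow_self.le
      _ ≤ m i ^ σ i := Nat.pow_le_pow_left (hm2 i) _
      _ ≤ ∏ i ∈ Finset.Ico 1 j, m i ^ σ i :=
        Finset.single_le_prod' (f := fun i => m i ^ σ i)
          (fun i _ => Nat.one_le_pow _ _ (by have := hm2 i; omega)) hi
      _ ≤ m j ^ 3 := hσ.le

theorem le_fSeq_of_pow_lt (hm2 : ∀ i, 2 ≤ m i) {r j : ℕ+} (hr : r < j) {k : ℕ}
    (h : m r ^ k < m j ^ 3) : k * n r ≤ fSeq m n j := by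
  have hrI : r ∈ Finset.Ico 1 j := Finset.mem_Ico.2 ⟨one_le, hr⟩
  have h1 := sum_le_fSeq (n := n) hm2 (j := j) (ρ := fun i => if r = i then k else 0) (by
    simpa [Finset.prod_ite_eq, pow_ite, hrI] using h)
  simpa [ite_mul, Finset.sum_ite_eq, hrI] using h1

theorem le_fSeq (hm2 : ∀ i, 2 ≤ m i) (hmono : StrictMono m) {r j : ℕ+} (hr : r < j) :
    n r ≤ fSeq m n j := by
  have h := le_fSeq_of_pow_lt (n := n) hm2 hr (k := 1) (by
    rw [pow_one]
    exact (hmono hr).trans_le (Nat.le_self_pow (by norm_num) _))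
  rwa [one_mul] at h

theorem IsParameterPair.seven_le (hml : IsParameterPair m l) (i : ℕ+) : 7 ≤ m i :=
  hml.six_lt.trans_le (hml.strictMono_m.monotone one_le)

theorem IsParameterPair.one_le_m (hml : IsParameterPair m l) (i : ℕ+) : 1 ≤ m i := by
  have := hml.seven_le i
  omega

theorem IsParameterPair.two_le_m (hml : IsParameterPair m l) (i : ℕ+) : 2 ≤ m i := by
  have := hml.seven_le i
  omega

theorem pnat_le_of_strictMono {φ : ℕ+ → ℕ} (h : StrictMono φ) (h1 : 1 ≤ φ 1) (i : ℕ+) :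
    (i : ℕ) ≤ φ i := by
  induction i using PNat.recOn with
  | one => simpa using h1
  | succ i ih =>
    have := h (PNat.lt_add_right i 1)
    rw [PNat.add_coe, PNat.one_coe]
    omega

/-! ### Averages of rapidly increasing sequences are small -/

theorem norm_average_le_of_isRapid (hm : ∀ j, 1 ≤ m j) (hm2 : ∀ j, 2 ≤ m j) (hmono : StrictMono m)
    {j : ℕ+} {v : ℕ+ → ℕ+ →₀ ℝ} (hv : IsSuccessive v)
    (hv1 : ∀ k, tsirelsonNorm n hm (v k) = 1) (hrap : IsRapid m n j v) {b : ℕ+ →₀ ℝ}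
    (hb : 0 ≤ b) (hb1 : coeffSum b = 1)
    (hsmall : IsSmallOn (lastPoint v) (fSeq m n j) (1 / (m j : ℝ) ^ 2) b) :
    tsirelsonNorm n hm (Finsupp.linearCombination ℝ v b) ≤ 3 / m j + 3 / (m j : ℝ) ^ 2 := by
  classical
  have h0 : ∀ k, v k ≠ 0 := fun k => NormingSet.ne_zero_of_norm_eq_one _ (hv1 k)
  have hmj : (0 : ℝ) < m j := by exact_mod_cast hm j
  refine NormingSet.norm_le _ fun f hf => ?_
  obtain ⟨G, C, hG, hC, -, -, -, hbound⟩ := exists_exceptional_sets hm hmono hv hv1 hrap hf 1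
    (fSeq m n j) (fun ρ hρ => sum_le_fSeq hm2 (by rwa [one_mul] at hρ))
  let L := b.support.filter fun k => IsCut G (v k)
  have hL : L.image (lastPoint v) ∈ schreier (fSeq m n j) := by
    have hτ : ∀ k, ∃ g, k ∈ L → g ∈ G ∧ ∃ a ∈ (v k).support, ∃ p ∈ (v k).support, a < g ∧ g ≤ p := by
      intro k
      by_cases hk : k ∈ L
      · obtain ⟨-, a, ha, p, hp, g, hg, h1, h2⟩ := Finset.mem_filter.1 hk
        exact ⟨g, fun _ => ⟨hg, a, ha, p, hp, h1, h2⟩⟩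
      · exact ⟨1, fun h => absurd h hk⟩
    choose τ hτ using hτ
    refine image_mem_schreier (τ := τ) hG (fun k hk => (hτ k hk).1) ?_ ?_
      fun k _ k' _ h => hv.strictMono_lastPoint h0 h
    · intro k hk
      obtain ⟨-, -, -, p, hp, -, h⟩ := hτ k hk
      exact h.trans (le_lastPoint hp)
    · intro k hk k' hk' hkk
      obtain ⟨-, -, -, p, hp, -, h⟩ := hτ k hk
      obtain ⟨-, a, ha, -, -, h', -⟩ := hτ k' hk'
      exact h.trans_lt ((hv k k' hkk p hp a ha).trans h')
  rw [pairing_linearCombination]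
  have hterm : ∀ k ∈ b.support, b k * pairing (v k) f ≤
      b k * (3 / m j + 1 / (m j : ℝ) ^ 2) + (if k ∈ C then b k else 0) +
        (if k ∈ L then b k else 0) := by
    intro k hk
    have hbk : 0 ≤ b k := hb k
    have hone : pairing (v k) f ≤ 1 := by
      rw [← hv1 k]
      exact (normingSet n hm).pairing_le_norm hf (v k)
    have hnn : 0 ≤ b k * (3 / m j + 1 / (m j : ℝ) ^ 2) := by positivity
    have hle1 : b k * pairing (v k) f ≤ b k := mul_le_of_le_one_right hbk hone
    by_cases hkC : k ∈ C
    · rw [if_pos hkC]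
      split_ifs <;> linarith
    · by_cases hkL : k ∈ L
      · rw [if_pos hkL, if_neg hkC]
        linarith
      · rw [if_neg hkC, if_neg hkL, add_zero, add_zero]
        refine mul_le_mul_of_nonneg_left ?_ hbk
        have := hbound k hkC fun h => hkL (Finset.mem_filter.2 ⟨hk, h⟩)
        rw [Nat.cast_one] at this
        exact (le_abs_self _).trans this
  refine (Finset.sum_le_sum hterm).trans ?_
  have hmass : ∀ B : Finset ℕ+, B.image (lastPoint v) ∈ schreier (fSeq m n j) →
      ∑ k ∈ b.support, (if k ∈ B then b k else 0) ≤ 1 / (m j : ℝ) ^ 2 := by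
    intro B hB
    rw [← Finset.sum_filter]
    refine hsmall _ (schreier_hereditary hB (Finset.image_subset_image ?_))
    intro k hk
    exact (Finset.mem_filter.1 hk).2
  rw [Finset.sum_add_distrib, Finset.sum_add_distrib, ← Finset.sum_mul, ← coeffSum_apply, hb1,
    one_mul]
  have h1 := hmass C hC
  have h2 := hmass L hL
  have h3 : (3 : ℝ) / (m j : ℝ) ^ 2 = 1 / (m j : ℝ) ^ 2 + 1 / (m j : ℝ) ^ 2 +
    1 / (m j : ℝ) ^ 2 := by ring
  linarith

theorem exists_average_norm_lt (hm : ∀ j, 1 ≤ m j) (hm2 : ∀ j, 2 ≤ m j) (hmono : StrictMono m)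
    {j : ℕ+} {v : ℕ+ → ℕ+ →₀ ℝ} (hv : IsSuccessive v)
    (hv1 : ∀ k, tsirelsonNorm n hm (v k) = 1) (hrap : IsRapid m n j v) :
    ∃ b : ℕ+ →₀ ℝ, 0 ≤ b ∧ coeffSum b = 1 ∧ b.support ∈ schreier (fSeq m n j + 1) ∧
      tsirelsonNorm n hm (Finsupp.linearCombination ℝ v b) < 6 / m j := by
  have h0 : ∀ k, v k ≠ 0 := fun k => NormingSet.ne_zero_of_norm_eq_one _ (hv1 k)
  have hmj : (1 : ℝ) < m j := by exact_mod_cast hm2 j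
  obtain ⟨b, hb, hb1, hbS, -, hsmall⟩ := exists_average (hv.strictMono_lastPoint h0)
    (fSeq m n j + 1) (ε := 1 / (m j : ℝ) ^ 2) (by positivity) 1
  refine ⟨b, hb, hb1, hbS, (norm_average_le_of_isRapid hm hm2 hmono hv hv1 hrap hb hb1
    (hsmall _ (Nat.lt_succ_self _))).trans_lt ?_⟩
  have h1 : (3 : ℝ) / (m j : ℝ) ^ 2 < 3 / m j := by
    refine div_lt_div_of_pos_left (by norm_num) (by linarith) ?_
    nlinarith
  have h2 : (6 : ℝ) / m j = 3 / m j + 3 / m j := by ring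
  linarith

/-! ### Averages with large norm -/

/-- Some average of order `f_i + 1`, small on `S_{f_i}`, of some normalized blocks of `u` has norm
at least `1/2`.  Otherwise normalized averages of normalized averages, `l_i` times iterated, would
be unit vectors with coefficients of sum at least `2 ^ l_i > m_i` on a set in `S_{n_i}`, against
the lower `ℓ₁` estimate. -/
theorem exists_large_average (hml : IsParameterPair m l) (hn : IsGood m l n)
    {u : ℕ+ → ℕ+ →₀ ℝ} (hu : IsSuccessive u)
    (hu1 : ∀ t, tsirelsonNorm n hml.one_le_m (u t) = 1) (i : ℕ+) {ε : ℝ} (hε : 0 < ε) (N : ℕ+) :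
    ∃ d : ℕ+ → ℕ+ →₀ ℝ, IsSuccessive d ∧ (∀ t, 0 ≤ d t) ∧
      (∀ t, tsirelsonNorm n hml.one_le_m (Finsupp.linearCombination ℝ u (d t)) = 1) ∧
      ∃ b : ℕ+ →₀ ℝ, 0 ≤ b ∧ coeffSum b = 1 ∧ (∀ t ∈ b.support, N ≤ t) ∧
        IsSmallOn (lastPoint fun t => Finsupp.linearCombination ℝ u (d t)) (fSeq m n i) ε b ∧
        1 / 2 ≤ tsirelsonNorm n hml.one_le_m
          (Finsupp.linearCombination ℝ (fun t => Finsupp.linearCombination ℝ u (d t)) b) := by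
  by_contra! hcon
  set hm := hml.one_le_m
  have hiter : ∀ k : ℕ, ∃ d : ℕ+ → ℕ+ →₀ ℝ, IsSuccessive d ∧ (∀ t, 0 ≤ d t) ∧
      (∀ t, tsirelsonNorm n hm (Finsupp.linearCombination ℝ u (d t)) = 1) ∧
      (∀ t, (d t).support ∈ schreier (k * (fSeq m n i + 1))) ∧ ∀ t, 2 ^ k ≤ coeffSum (d t) := by
    intro k
    induction k with
    | zero =>
      refine ⟨fun t => Finsupp.single t 1, fun t t' h p hp p' hp' => ?_,
        fun t => Finsupp.single_nonneg.2 zero_le_one, fun t => by simpa using hu1 t, fun t => ?_,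
        fun t => by simp [coeffSum]⟩
      · rw [Finset.mem_singleton.1 (Finsupp.support_single_subset hp),
          Finset.mem_singleton.1 (Finsupp.support_single_subset hp')]
        exact h
      · rw [Finsupp.support_single t one_ne_zero]
        exact singleton_mem_schreier _ t
    | succ k ih =>
      obtain ⟨d, hd, hd0, hd1, hdS, hdsum⟩ := ih
      have hw := hu.linearCombination hd
      have hw0 : ∀ t, Finsupp.linearCombination ℝ u (d t) ≠ 0 := fun t =>
        NormingSet.ne_zero_of_norm_eq_one _ (hd1 t)
      have hdne : ∀ t, d t ≠ 0 := fun t h => hw0 t (by rw [h, map_zero])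
      have hav := fun N => exists_average (hw.strictMono_lastPoint hw0) (fSeq m n i + 1) hε N
      obtain ⟨b, hb, -, hbs⟩ := exists_successive_seq (fun b : ℕ+ →₀ ℝ => b.support)
        (P := fun b => 0 ≤ b ∧ coeffSum b = 1 ∧ b.support ∈ schreier (fSeq m n i + 1) ∧
          (∀ t ∈ b.support, N ≤ t) ∧
          IsSmallOn (lastPoint fun t => Finsupp.linearCombination ℝ u (d t)) (fSeq m n i) ε b)
        (R := fun _ _ => True)
        (by
          obtain ⟨b, h1, h2, h3, h4, h5⟩ := hav N
          exact ⟨b, h1, h2, h3, h4, h5 _ (Nat.lt_succ_self _)⟩)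
        (by
          rintro b ⟨-, hb1, -⟩
          refine Finsupp.support_nonempty_iff.2 fun h => ?_
          simp [h] at hb1)
        (by
          rintro - - N'
          obtain ⟨b, h1, h2, h3, h4, h5⟩ := hav (max N N')
          exact ⟨b, ⟨h1, h2, h3, fun t ht => (le_max_left _ _).trans (h4 t ht),
            h5 _ (Nat.lt_succ_self _)⟩, trivial, fun t ht => (le_max_right _ _).trans (h4 t ht)⟩)
      have hlt : ∀ t, tsirelsonNorm n hm
          (Finsupp.linearCombination ℝ u (Finsupp.linearCombination ℝ d (b t))) < 1 / 2 := by
        intro t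
        rw [← linearCombination_linearCombination]
        exact hcon d hd hd0 hd1 (b t) (hb t).1 (hb t).2.1 (hb t).2.2.2.1 (hb t).2.2.2.2
      have hpos : ∀ t, 0 < tsirelsonNorm n hm
          (Finsupp.linearCombination ℝ u (Finsupp.linearCombination ℝ d (b t))) := by
        intro t
        have hbt : b t ≠ 0 := fun h => by simpa [h] using (hb t).2.1
        obtain ⟨s, hs⟩ := Finsupp.ne_iff.1 hbt
        rw [← linearCombination_linearCombination]
        have h := hw.abs_mul_norm_le hm (n := n) (b t) s
        rw [hd1, mul_one] at h
        exact (abs_pos.2 hs).trans_le h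
      refine ⟨fun t => (tsirelsonNorm n hm
          (Finsupp.linearCombination ℝ u (Finsupp.linearCombination ℝ d (b t))))⁻¹ •
            Finsupp.linearCombination ℝ d (b t), ?_, ?_, ?_, ?_, ?_⟩
      · exact fun t t' h => ((hd.linearCombination hbs) t t' h).mono Finsupp.support_smul
          Finsupp.support_smul
      · exact fun t => smul_nonneg (inv_nonneg.2 (hpos t).le)
          (linearCombination_nonneg hd0 (hb t).1)
      · intro t
        rw [map_smul, map_smul_eq_mul, Real.norm_of_nonneg (inv_nonneg.2 (hpos t).le)]
        exact inv_mul_cancel₀ (hpos t).ne'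
      · intro t
        have h := biUnion_mem_schreier (hb t).2.2.1 (fun s _ => hdS s)
          (fun s _ p hp => hd.le_of_mem hdne hp) fun s _ s' _ h => hd s s' h
        rw [show (k + 1) * (fSeq m n i + 1) = fSeq m n i + 1 + k * (fSeq m n i + 1) by ring]
        refine schreier_hereditary h fun p hp => ?_
        exact Finset.mem_biUnion.2 (mem_support_linearCombination (Finsupp.support_smul hp))
      · intro t
        have hsum : 2 ^ k ≤ coeffSum (Finsupp.linearCombination ℝ d (b t)) := by
          rw [Finsupp.linearCombination_apply, Finsupp.sum, map_sum]
          calc (2 : ℝ) ^ k = ∑ s ∈ (b t).support, b t s * 2 ^ k := by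
                rw [← Finset.sum_mul, ← coeffSum_apply, (hb t).2.1, one_mul]
            _ ≤ ∑ s ∈ (b t).support, coeffSum (b t s • d s) := by
                refine Finset.sum_le_sum fun s _ => ?_
                rw [map_smul, smul_eq_mul]
                exact mul_le_mul_of_nonneg_left (hdsum s) ((hb t).1 s)
        rw [map_smul, smul_eq_mul, ← div_eq_inv_mul, le_div_iff₀ (hpos t), pow_succ]
        have h2k : (0 : ℝ) < 2 ^ k := by positivity
        nlinarith [hlt t]
  obtain ⟨d, hd, hd0, hd1, hdS, hdsum⟩ := hiter (l i)
  have h1 := hu.sum_abs_le hm hu1 (j := i) (schreier_mono (hn.lt i).le (hdS 1))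
  rw [hd1, mul_one, Finset.sum_congr rfl fun t _ => abs_of_nonneg (hd0 1 t),
    ← coeffSum_apply] at h1
  have h2 : (m i : ℝ) < 2 ^ l i := by exact_mod_cast hml.lt_two_pow i
  linarith [hdsum 1]

/-- Every block sequence has blocks of norm one on which all functionals of weight `m_r`, `r < i`,
are at most `3/m_r`. -/
theorem exists_block_of_small_weights (hml : IsParameterPair m l) (hn : IsGood m l n)
    {u : ℕ+ → ℕ+ →₀ ℝ} (hu : IsSuccessive u)
    (hu1 : ∀ t, tsirelsonNorm n hml.one_le_m (u t) = 1) (i N : ℕ+) :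
    ∃ c : ℕ+ →₀ ℝ, 0 ≤ c ∧ (∀ t ∈ c.support, N ≤ t) ∧
      tsirelsonNorm n hml.one_le_m (Finsupp.linearCombination ℝ u c) = 1 ∧
      ∀ r < i, ∀ f, IsLayer m n r f →
        |pairing (Finsupp.linearCombination ℝ u c) ((m r : ℝ)⁻¹ • f)| ≤ 3 / m r := by
  have hmpos : ∀ r, (0 : ℝ) < m r := fun r => by exact_mod_cast hml.one_le_m r
  obtain ⟨d, hd, hd0, hd1, b, hb, hb1, hbN, hsmall, hhalf⟩ := exists_large_average hml hn hu hu1 i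
    (ε := 1 / (2 * m i)) (by have := hmpos i; positivity) N
  have hw := hu.linearCombination hd
  have hdne : ∀ t, d t ≠ 0 := fun t h => by simpa [h] using hd1 t
  rw [linearCombination_linearCombination] at hhalf
  set s := tsirelsonNorm n hml.one_le_m
    (Finsupp.linearCombination ℝ u (Finsupp.linearCombination ℝ d b)) with hs
  have hspos : 0 < s := by linarith
  refine ⟨s⁻¹ • Finsupp.linearCombination ℝ d b,
    smul_nonneg (inv_nonneg.2 hspos.le) (linearCombination_nonneg hd0 hb), ?_, ?_, ?_⟩
  · intro p hp
    obtain ⟨t, ht, hpt⟩ := mem_support_linearCombination (Finsupp.support_smul hp)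
    exact (hbN t ht).trans (hd.le_of_mem hdne hpt)
  · rw [map_smul, map_smul_eq_mul, Real.norm_of_nonneg (inv_nonneg.2 hspos.le), ← hs]
    exact inv_mul_cancel₀ hspos.ne'
  · intro r hr f hf
    have h1 := abs_pairing_average_le hml.one_le_m hw hd1 hb hb1
      (hsmall.mono (le_fSeq hml.two_le_m hml.strictMono_m hr) le_rfl) hf
    rw [linearCombination_linearCombination] at h1
    have hmr : (m r : ℝ) ≤ m i := by exact_mod_cast (hml.strictMono_m hr).le
    have h2 : (m r : ℝ) * (1 / (2 * m i)) ≤ 1 / 2 := by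
      have := hmpos i
      rw [mul_one_div, div_le_div_iff₀ (by positivity) two_pos]
      linarith
    rw [map_smul, NormingSet.pairing_smul, pairing_smul_right, abs_mul, abs_mul,
      abs_of_nonneg (inv_nonneg.2 hspos.le), abs_of_nonneg (inv_nonneg.2 (hmpos r).le),
      ← div_eq_inv_mul, ← div_eq_inv_mul, div_right_comm]
    refine div_le_div_of_nonneg_right ?_ (hmpos r).le
    rw [div_le_iff₀ hspos]
    linarith

/-- Every block sequence has a rapidly increasing sequence of blocks. -/
theorem exists_isRapid (hml : IsParameterPair m l) (hn : IsGood m l n)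
    {u : ℕ+ → ℕ+ →₀ ℝ} (hu : IsSuccessive u)
    (hu1 : ∀ t, tsirelsonNorm n hml.one_le_m (u t) = 1) (j : ℕ+) :
    ∃ c : ℕ+ → ℕ+ →₀ ℝ, IsSuccessive c ∧ (∀ k, 0 ≤ c k) ∧
      (∀ k, tsirelsonNorm n hml.one_le_m (Finsupp.linearCombination ℝ u (c k)) = 1) ∧
      IsRapid m n j fun k => Finsupp.linearCombination ℝ u (c k) := by
  have hmpos : ∀ r, (0 : ℝ) < m r := fun r => by exact_mod_cast hml.one_le_m r
  obtain ⟨s, hP, hR, hsucc⟩ := exists_successive_seq (fun x : ℕ+ × (ℕ+ →₀ ℝ) => x.2.support)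
    (P := fun x => 0 ≤ x.2 ∧
      tsirelsonNorm n hml.one_le_m (Finsupp.linearCombination ℝ u x.2) = 1 ∧
      ∀ r < x.1, ∀ f, IsLayer m n r f →
        |pairing (Finsupp.linearCombination ℝ u x.2) ((m r : ℝ)⁻¹ • f)| ≤ 3 / m r)
    (R := fun x y => x.1 < y.1 ∧ (m j : ℝ) * ∑ p ∈ (Finsupp.linearCombination ℝ u x.2).support,
      |Finsupp.linearCombination ℝ u x.2 p| ≤ m y.1)
    (by
      obtain ⟨c, h1, -, h2, h3⟩ := exists_block_of_small_weights hml hn hu hu1 1 1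
      exact ⟨(1, c), h1, h2, h3⟩)
    (by
      rintro ⟨i, c⟩ ⟨-, h, -⟩
      refine Finsupp.support_nonempty_iff.2 fun hc => ?_
      dsimp only at hc h
      simp [hc] at h)
    (by
      rintro ⟨i, c⟩ - N
      obtain ⟨k, hk⟩ := exists_nat_ge ((m j : ℝ) *
        ∑ p ∈ (Finsupp.linearCombination ℝ u c).support, |Finsupp.linearCombination ℝ u c p|)
      obtain ⟨c', h1, h2, h3, h4⟩ := exists_block_of_small_weights hml hn hu hu1
        (i + k.succPNat) N
      refine ⟨(i + k.succPNat, c'), ⟨h1, h3, h4⟩, ⟨PNat.lt_add_right i _, hk.trans ?_⟩, h2⟩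
      have h5 := pnat_le_of_strictMono hml.strictMono_m (hml.one_le_m 1) (i + k.succPNat)
      rw [PNat.add_coe, Nat.succPNat_coe] at h5
      dsimp only
      exact_mod_cast (by omega : k ≤ m (i + k.succPNat)))
  refine ⟨fun k => (s k).2, hsucc, fun k => (hP k).1, fun k => (hP k).2.1, ?_⟩
  have hind : ∀ k k', k < k' → (s k).1 < (s k').1 := fun k k' h =>
    pnat_rel_of_lt (R := fun x y : ℕ+ × (ℕ+ →₀ ℝ) => x.1 < y.1) (fun _ _ _ h h' => h.trans h')
      (fun i => (hR i).1) h
  intro r hr f hf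
  have hmjr : (m j : ℝ) ≤ m r := by exact_mod_cast hml.strictMono_m.monotone hr
  have hlow : ∀ k, r < (s k).1 →
      |pairing (Finsupp.linearCombination ℝ u (s k).2) ((m r : ℝ)⁻¹ • f)| ≤ 3 / m j := fun k hk =>
    ((hP k).2.2 r hk f hf).trans (div_le_div_of_nonneg_left (by norm_num) (hmpos j) hmjr)
  have hhigh : ∀ k, (s (k + 1)).1 ≤ r →
      |pairing (Finsupp.linearCombination ℝ u (s k).2) ((m r : ℝ)⁻¹ • f)| ≤ 3 / m j := by
    intro k hk
    have h1 := abs_pairing_le_of_abs_le (x := Finsupp.linearCombination ℝ u (s k).2)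
      (hf.abs_apply_le hml.one_le_m)
    rw [one_mul] at h1
    have h2 := (hR k).2
    have h3 : (m (s (k + 1)).1 : ℝ) ≤ m r := by exact_mod_cast hml.strictMono_m.monotone hk
    rw [pairing_smul_right, abs_mul, abs_of_nonneg (inv_nonneg.2 (hmpos r).le), ← div_eq_inv_mul,
      div_le_div_iff₀ (hmpos r) (hmpos j)]
    have h4 := mul_le_mul_of_nonneg_right h1 (hmpos j).le
    have h5 := hmpos r
    linarith
  by_cases hex : ∃ k₀, (s k₀).1 ≤ r ∧ r < (s (k₀ + 1)).1
  · obtain ⟨k₀, h1, h2⟩ := hex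
    refine ⟨k₀, fun k hk => ?_⟩
    rcases lt_or_gt_of_ne hk with h | h
    · refine hhigh k (le_trans ?_ h1)
      rcases (PNat.add_one_le_iff.2 h).lt_or_eq with h' | h'
      · exact (hind _ _ h').le
      · rw [h']
    · refine hlow k (h2.trans_le ?_)
      rcases (PNat.add_one_le_iff.2 h).lt_or_eq with h' | h'
      · exact (hind _ _ h').le
      · rw [h']
  · push Not at hex
    refine ⟨1, fun k _ => ?_⟩
    rcases lt_or_ge r (s k).1 with h | h
    · exact hlow k h
    · exact hhigh k (hex k h)

end

section

/-! ### Completions of `c_00` -/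

section Completion

variable (q : Seminorm ℝ (ℕ+ →₀ ℝ))

/-- The canonical map from `c_00` to its completion under `q`. -/
def toSpace : (ℕ+ →₀ ℝ) →ₗ[ℝ] CompletedC00 q where
  toFun x := ((C00.mk q x : C00 q) : UniformSpace.Completion (C00 q))
  map_add' x y := UniformSpace.Completion.coe_add (C00.mk q x) (C00.mk q y)
  map_smul' r x := UniformSpace.Completion.coe_smul r (C00.mk q x)

theorem norm_toSpace (x : ℕ+ →₀ ℝ) : ‖toSpace q x‖ = q x :=
  UniformSpace.Completion.norm_coe (C00.mk q x)

theorem denseRange_toSpace : DenseRange (toSpace q) :=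
  UniformSpace.Completion.denseRange_coe (α := C00 q)

theorem toSpace_single (i : ℕ+) (r : ℝ) : toSpace q (Finsupp.single i r) = r • unitVec q i := by
  have h : Finsupp.single i r = r • Finsupp.single i (1 : ℝ) := by simp
  rw [h, map_smul]
  rfl

/-- The vector of `c_00` with coefficients `a i` for `i ∈ F`, and `0` elsewhere. -/
def restrictTo (F : Finset ℕ+) (a : ℕ+ → ℝ) : ℕ+ →₀ ℝ := ∑ i ∈ F, Finsupp.single i (a i)

theorem restrictTo_apply (F : Finset ℕ+) (a : ℕ+ → ℝ) (i : ℕ+) :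
    restrictTo F a i = if i ∈ F then a i else 0 := by
  simp [restrictTo, Finsupp.finsetSum_apply, Finsupp.single_apply]

theorem support_restrictTo_subset (F : Finset ℕ+) (a : ℕ+ → ℝ) :
    (restrictTo F a).support ⊆ F := by
  intro i hi
  rw [Finsupp.mem_support_iff, restrictTo_apply] at hi
  by_contra h
  exact hi (if_neg h)

theorem toSpace_restrictTo (F : Finset ℕ+) (a : ℕ+ → ℝ) :
    toSpace q (restrictTo F a) = ∑ i ∈ F, a i • unitVec q i := by
  rw [restrictTo, map_sum]
  exact Finset.sum_congr rfl fun i _ => toSpace_single q i (a i)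

theorem linearCombination_restrictTo {V : Type*} [AddCommGroup V] [Module ℝ V] (u : ℕ+ → V)
    (F : Finset ℕ+) (a : ℕ+ → ℝ) :
    Finsupp.linearCombination ℝ u (restrictTo F a) = ∑ i ∈ F, a i • u i := by
  rw [restrictTo, map_sum]
  exact Finset.sum_congr rfl fun i _ => Finsupp.linearCombination_single ℝ (a i) i

theorem sum_abs_restrictTo (F : Finset ℕ+) (a : ℕ+ → ℝ) :
    ∑ i ∈ (restrictTo F a).support, |restrictTo F a i| = ∑ i ∈ F, |a i| := by
  rw [Finset.sum_subset (support_restrictTo_subset F a) fun i _ hi => by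
    rw [Finsupp.notMem_support_iff.1 hi, abs_zero]]
  exact Finset.sum_congr rfl fun i hi => by rw [restrictTo_apply, if_pos hi]

theorem exists_isometry_of_eq {q q' : Seminorm ℝ (ℕ+ →₀ ℝ)} (h : q = q') :
    ∃ Φ : CompletedC00 q ≃ₗᵢ[ℝ] CompletedC00 q', ∀ i, Φ (unitVec q i) = unitVec q' i := by
  subst h
  exact ⟨LinearIsometryEquiv.refl ℝ _, fun _ => rfl⟩

end Completion

/-! ### The unit vector basis -/

namespace NormingSet

variable (𝓜 : NormingSet)

/-- The coordinate functionals on `X_𝓜`. -/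
def coord (i : ℕ+) : 𝓜.Space →L[ℝ] ℝ :=
  (Finsupp.lapply (R := ℝ) i : (ℕ+ →₀ ℝ) →ₗ[ℝ] ℝ).extendOfNorm (toSpace 𝓜.norm)

theorem coord_toSpace (i : ℕ+) (x : ℕ+ →₀ ℝ) : 𝓜.coord i (toSpace 𝓜.norm x) = x i :=
  LinearMap.extendOfNorm_eq (denseRange_toSpace _) ⟨1, fun x => by
    rw [norm_toSpace, one_mul]
    exact 𝓜.abs_apply_le_norm x i⟩ x

theorem norm_filter_le_le (x : ℕ+ →₀ ℝ) (k : ℕ+) :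
    𝓜.norm (x.filter fun i => i ≤ k) ≤ 𝓜.norm x := by
  refine 𝓜.norm_le fun μ hμ => ?_
  rw [← pairing_filter]
  exact 𝓜.pairing_le_norm (𝓜.restrict_mem μ hμ k) x

/-- The projection onto the span of the first `k` unit vectors. -/
def initialProj (k : ℕ+) : 𝓜.Space →L[ℝ] 𝓜.Space :=
  ∑ i ∈ Finset.Iic k, (𝓜.coord i).smulRight (𝓜.e i)

theorem initialProj_apply (k : ℕ+) (z : 𝓜.Space) :
    𝓜.initialProj k z = ∑ i ∈ Finset.Iic k, 𝓜.coord i z • 𝓜.e i := by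
  simp [initialProj]

theorem initialProj_toSpace (k : ℕ+) (x : ℕ+ →₀ ℝ) :
    𝓜.initialProj k (toSpace 𝓜.norm x) = toSpace 𝓜.norm (x.filter fun i => i ≤ k) := by
  have h : x.filter (fun i => i ≤ k) = restrictTo (Finset.Iic k) x := by
    ext i
    rw [restrictTo_apply, Finsupp.filter_apply]
    simp only [Finset.mem_Iic]
  rw [h, toSpace_restrictTo, initialProj_apply]
  exact Finset.sum_congr rfl fun i _ => by rw [coord_toSpace]

theorem norm_initialProj_le (k : ℕ+) (z : 𝓜.Space) : ‖𝓜.initialProj k z‖ ≤ ‖z‖ := by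
  refine (denseRange_toSpace 𝓜.norm).induction_on z
    (isClosed_le (by fun_prop) continuous_norm) fun x => ?_
  rw [initialProj_toSpace, norm_toSpace, norm_toSpace]
  exact 𝓜.norm_filter_le_le x k

theorem tendsto_initialProj (z : 𝓜.Space) :
    Tendsto (fun k => 𝓜.initialProj k z) atTop (𝓝 z) := by
  rw [Metric.tendsto_atTop]
  intro ε hε
  obtain ⟨x, hx⟩ := (denseRange_toSpace 𝓜.norm).exists_dist_lt z (half_pos hε)
  refine ⟨x.support.sup id, fun k hk => ?_⟩
  have hfix : 𝓜.initialProj k (toSpace 𝓜.norm x) = toSpace 𝓜.norm x := by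
    rw [initialProj_toSpace, (Finsupp.filter_eq_self_iff _ _).2]
    exact fun i hi => (Finset.le_sup (f := id) (Finsupp.mem_support_iff.2 hi)).trans hk
  have h1 : 𝓜.initialProj k z - z =
      𝓜.initialProj k (z - toSpace 𝓜.norm x) - (z - toSpace 𝓜.norm x) := by
    rw [map_sub, hfix]
    abel
  rw [dist_eq_norm] at hx ⊢
  rw [h1]
  refine (norm_sub_le _ _).trans_lt ?_
  have h2 := 𝓜.norm_initialProj_le k (z - toSpace 𝓜.norm x)
  linarith

theorem isSchauderBasis : IsSchauderBasis 𝓜.e := by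
  refine ⟨⟨𝓜.e, 𝓜.coord, fun i j => ?_, fun z => ?_⟩, rfl⟩
  · have h := 𝓜.coord_toSpace i (Finsupp.single j 1)
    rw [toSpace_single, one_smul] at h
    rw [h, Finsupp.single_eq_pi_single]
    congr!
  · have h := 𝓜.tendsto_initialProj z
    simp only [initialProj_apply] at h
    rw [HasSum, SummationFilter.conditional_filter_eq_map_Iic, tendsto_map'_iff]
    exact h

end NormingSet

theorem norm_sum_unitVec (𝓜 : NormingSet) (F : Finset ℕ+) (a : ℕ+ → ℝ) :
    ‖∑ i ∈ F, a i • 𝓜.e i‖ = 𝓜.norm (restrictTo F a) := by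
  rw [← toSpace_restrictTo, norm_toSpace]

variable {m n : ℕ+ → ℕ}

theorem isOneUnconditional_normingSet (hm : ∀ j, 1 ≤ m j) :
    IsOneUnconditional (normingSet n hm).e := by
  intro F a ε hε
  rw [norm_sum_unitVec _ F (fun i => ε i * a i), norm_sum_unitVec]
  have h : restrictTo F (fun i => ε i * a i) = ε • restrictTo F a := by
    ext i
    by_cases hi : i ∈ F <;> simp [restrictTo_apply, hi]
  rw [h]
  exact tsirelsonNorm_pointwise_smul_le hm _ fun i => Or.inr (hε i)

theorem isBimonotone_normingSet (hm : ∀ j, 1 ≤ m j) : IsBimonotone (normingSet n hm).e := by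
  intro N k l a hl
  rw [norm_sum_unitVec, norm_sum_unitVec]
  have h : restrictTo (Finset.Icc k l) a =
      (restrictTo (Finset.Icc 1 N) a).filter (fun i => i ∈ Finset.Icc k l) := by
    ext i
    by_cases hi : i ∈ Finset.Icc k l
    · rw [Finsupp.filter_apply_pos _ _ hi, restrictTo_apply, restrictTo_apply, if_pos hi, if_pos]
      exact Finset.mem_Icc.2 ⟨one_le, (Finset.mem_Icc.1 hi).2.trans hl⟩
    · rw [Finsupp.filter_apply_neg _ _ hi, restrictTo_apply, if_neg hi]
  rw [h]
  exact tsirelsonNorm_filter_le hm _ _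

/-! ### Block bases -/

theorem isBlockBasis_of_sum {X : Type*} [NormedAddCommGroup X] [NormedSpace ℝ X] {e v : ℕ+ → X}
    {F : ℕ+ → Finset ℕ+} {c : ℕ+ → ℕ+ → ℝ} (hF : ∀ i j, i < j → FinsetLT (F i) (F j))
    (hv : ∀ k, v k = ∑ i ∈ F k, c k i • e i) (hv0 : ∀ k, v k ≠ 0) : IsBlockBasis e v := by
  classical
  let a : ℕ+ → ℝ := fun i => if h : ∃ k, i ∈ F k then c h.choose i else 0
  refine ⟨F, a, hF, fun k => ⟨?_, hv0 k⟩⟩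
  rw [hv]
  refine Finset.sum_congr rfl fun i hi => ?_
  have h : ∃ k, i ∈ F k := ⟨k, hi⟩
  have hk : h.choose = k := by
    rcases lt_trichotomy h.choose k with h' | h' | h'
    · exact absurd (hF _ _ h' i h.choose_spec i hi) (lt_irrefl i)
    · exact h'
    · exact absurd (hF _ _ h' i hi i h.choose_spec) (lt_irrefl i)
  simp only [a, dif_pos h, hk]

theorem IsBlockBasis.exists_successive {𝓜 : NormingSet} {u : ℕ+ → 𝓜.Space}
    (hu : IsBlockBasis 𝓜.e u) :
    ∃ x : ℕ+ → ℕ+ →₀ ℝ, IsSuccessive x ∧ ∀ k, u k = toSpace 𝓜.norm (x k) := by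
  obtain ⟨F, a, hF, hu⟩ := hu
  refine ⟨fun k => restrictTo (F k) a, fun i j hij => (hF i j hij).mono
    (support_restrictTo_subset _ _) (support_restrictTo_subset _ _), fun k => ?_⟩
  rw [toSpace_restrictTo, (hu k).1]

theorem isAsymptoticL1_normingSet (hm : ∀ j, 1 ≤ m j) {j : ℕ+} (hn : 1 ≤ n j) :
    IsAsymptoticL1 (normingSet n hm).e (1 / (m j : ℝ)) (n j) := by
  have hmj : (0 : ℝ) < m j := by exact_mod_cast hm j
  refine ⟨by positivity, hn, fun u hu hu1 => ⟨by positivity, hu1, fun F hF a => ?_⟩⟩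
  obtain ⟨x, hx, hux⟩ := hu.exists_successive
  have hx1 : ∀ t, tsirelsonNorm n hm (x t) = 1 := fun t => by
    rw [← norm_toSpace, ← hux, hu1 t]
  have h := hx.sum_abs_le hm hx1 (j := j) (schreier_hereditary hF (support_restrictTo_subset F a))
  rw [sum_abs_restrictTo, ← norm_toSpace, linearCombination_restrictTo, map_sum] at h
  have h2 : ∑ i ∈ F, a i • u i = ∑ i ∈ F, toSpace (tsirelsonNorm n hm) (a i • x i) :=
    Finset.sum_congr rfl fun i _ => by rw [map_smul, hux]
  rw [h2, one_div, inv_mul_le_iff₀ hmj]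
  exact h

end

section

variable {m l n : ℕ+ → ℕ}

/-! ### The modulus `τ` -/

/-- Multiplying the vectors of a sequence by scalars does not change the successive supports. -/
theorem IsSuccessive.smul {x : ℕ+ → ℕ+ →₀ ℝ} (hx : IsSuccessive x) (r : ℕ+ → ℝ) :
    IsSuccessive fun k => r k • x k :=
  fun i j hij => (hx i j hij).mono Finsupp.support_smul Finsupp.support_smul

theorem toSpace_linearCombination (q : Seminorm ℝ (ℕ+ →₀ ℝ)) (u : ℕ+ → ℕ+ →₀ ℝ) (c : ℕ+ →₀ ℝ) :
    toSpace q (Finsupp.linearCombination ℝ u c) = ∑ t ∈ c.support, c t • toSpace q (u t) := by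
  rw [Finsupp.linearCombination_apply, Finsupp.sum, map_sum]
  exact Finset.sum_congr rfl fun t _ => map_smul _ _ _

theorem tau_le_fSeq (hml : IsParameterPair m l) (hn : IsGood m l n)
    (hm : ∀ j, 1 ≤ m j) (j : ℕ+) {u : ℕ+ → (normingSet n hm).Space}
    (hu : IsBlockBasis (normingSet n hm).e u) :
    tau u (6 * (1 / (m j : ℝ))) ≤ (fSeq m n j : ℕ∞) := by
  set q := tsirelsonNorm n hm
  have hu0 : ∀ k, u k ≠ 0 := by
    obtain ⟨_, _, _, h⟩ := hu
    exact fun k => (h k).2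
  obtain ⟨x, hx, hux⟩ := hu.exists_successive
  have hq0 : ∀ k, 0 < q (x k) := fun k => by
    rw [← norm_toSpace, ← hux]
    exact norm_pos_iff.2 (hu0 k)
  obtain ⟨c, hc, hc0, hc1, hrap⟩ := exists_isRapid hml hn (hx.smul fun k => (q (x k))⁻¹)
    (fun k => by
      rw [map_smul_eq_mul, Real.norm_of_nonneg (inv_nonneg.2 (hq0 k).le)]
      exact inv_mul_cancel₀ (hq0 k).ne') j
  have hv := (hx.smul fun k => (q (x k))⁻¹).linearCombination hc
  set v := fun k => Finsupp.linearCombination ℝ (fun k => (q (x k))⁻¹ • x k) (c k)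
  have hvnorm : ∀ k, ‖toSpace q (v k)‖ = 1 := fun k => by rw [norm_toSpace, hc1]
  have hblock : IsBlockBasis u fun k => toSpace q (v k) := by
    refine isBlockBasis_of_sum (F := fun k => (c k).support)
      (c := fun k t => c k t * (q (x t))⁻¹) hc (fun k => ?_) fun k h => ?_
    · rw [toSpace_linearCombination]
      exact Finset.sum_congr rfl fun t _ => by rw [map_smul, smul_smul, hux]
    · have := hvnorm k
      rw [h] at this
      simp at this
  refine sSup_le ?_
  rintro _ ⟨ζ, rfl, hζ⟩
  by_contra hlt
  have hlt' : fSeq m n j + 1 ≤ ζ := by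
    rw [Nat.cast_le, not_le] at hlt
    exact hlt
  obtain ⟨k, hk, -, -, hk3⟩ := hζ _ hblock hvnorm
  obtain ⟨b, hb, hb1, hbS, hbnorm⟩ := exists_average_norm_lt hm hml.two_le_m hml.strictMono_m
    (hv.comp hk) (fun i => hc1 (k i)) (hrap.comp hk)
  have h := hk3 b.support (schreier_mono hlt' hbS) b
  have h2 : ∑ i ∈ b.support, b i • ((fun k => toSpace q (v k)) ∘ k) i =
      toSpace q (Finsupp.linearCombination ℝ (v ∘ k) b) := (toSpace_linearCombination q _ b).symm
  rw [h2, norm_toSpace, Finset.sum_congr rfl fun i _ => abs_of_nonneg (hb i), ← coeffSum_apply,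
    hb1, mul_one, mul_one_div] at h
  exact absurd hbnorm (not_lt.2 h)

/-! ### The basis is shrinking -/

theorem mul_coeffSum_le {ψ : (ℕ+ →₀ ℝ) →ₗ[ℝ] ℝ} {ε : ℝ} {u : ℕ+ → ℕ+ →₀ ℝ}
    (hu : ∀ t, ε ≤ ψ (u t)) {c : ℕ+ →₀ ℝ} (hc : 0 ≤ c) :
    ε * coeffSum c ≤ ψ (Finsupp.linearCombination ℝ u c) := by
  rw [Finsupp.linearCombination_apply, Finsupp.sum, map_sum, coeffSum_apply, Finset.mul_sum]
  refine Finset.sum_le_sum fun t _ => ?_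
  rw [map_smul, smul_eq_mul, mul_comm]
  exact mul_le_mul_of_nonneg_left (hu t) (hc t)

/-- A functional on the closed span of `e_k, e_{k+1}, …` is controlled by its values on `c_00`. -/
theorem norm_comp_subtypeL_le (𝓜 : NormingSet) {φ : 𝓜.Space →L[ℝ] ℝ} {ε : ℝ} (hε : 0 ≤ ε) {k : ℕ+}
    (h : ∀ x : ℕ+ →₀ ℝ, (∀ p ∈ x.support, k ≤ p) → |φ (toSpace 𝓜.norm x)| ≤ ε * 𝓜.norm x) :
    ‖φ.comp (Submodule.span ℝ (𝓜.e '' Set.Ici k)).topologicalClosure.subtypeL‖ ≤ ε := by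
  refine ContinuousLinearMap.opNorm_le_bound _ hε ?_
  rintro ⟨z, hz⟩
  have hspan : Submodule.span ℝ (𝓜.e '' Set.Ici k) ≤
      (Finsupp.supported ℝ ℝ (Set.Ici k)).map (toSpace 𝓜.norm) := by
    rw [Submodule.span_le]
    rintro _ ⟨i, hi, rfl⟩
    exact ⟨Finsupp.single i 1, Finsupp.single_mem_supported ℝ 1 hi, by
      rw [toSpace_single, one_smul]⟩
  have hclosed : IsClosed {z : 𝓜.Space | ‖φ z‖ ≤ ε * ‖z‖} :=
    isClosed_le (by fun_prop) (by fun_prop)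
  have hz' : z ∈ closure (Submodule.span ℝ (𝓜.e '' Set.Ici k) : Set 𝓜.Space) := hz
  refine closure_minimal (fun y hy => ?_) hclosed hz'
  obtain ⟨x, hx, rfl⟩ := hspan hy
  rw [Set.mem_ofPred_eq, norm_toSpace]
  exact h x fun p hp => (Finsupp.mem_supported ℝ x).1 hx hp

theorem isShrinking_normingSet (hml : IsParameterPair m l) (hn : IsGood m l n)
    (hm : ∀ j, 1 ≤ m j) : IsShrinking (normingSet n hm).e := by
  intro φ
  set q := tsirelsonNorm n hm
  set ψ : (ℕ+ →₀ ℝ) →ₗ[ℝ] ℝ := φ.toLinearMap ∘ₗ toSpace q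
  have hψ : ∀ x, ψ x = φ (toSpace q x) := fun _ => rfl
  -- Otherwise `φ` is bounded below on a normalized block sequence, hence on all convex
  -- combinations of its normalized positive blocks, and some of these have small norm.
  have key : ∀ ε > 0, ∃ N : ℕ+, ∀ x : ℕ+ →₀ ℝ, (∀ p ∈ x.support, N ≤ p) → |ψ x| ≤ ε * q x := by
    intro ε hε
    by_contra! hcon
    have hcon' : ∀ N : ℕ+, ∃ x : ℕ+ →₀ ℝ, (q x = 1 ∧ ε ≤ ψ x) ∧ True ∧ ∀ p ∈ x.support, N ≤ p := by
      intro N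
      obtain ⟨x, hxN, hx⟩ := hcon N
      have hx0 : x ≠ 0 := by
        rintro rfl
        simp at hx
      have hqx : 0 < q x := (normingSet n hm).norm_pos hx0
      refine ⟨(SignType.sign (ψ x) * (q x)⁻¹ : ℝ) • x, ⟨?_, ?_⟩, trivial,
        fun p hp => hxN p (Finsupp.support_smul hp)⟩
      · have hψ0 : ψ x ≠ 0 := by
          intro h0
          rw [h0, abs_zero] at hx
          exact absurd hx (not_lt.2 (by positivity))
        have hs : |((SignType.sign (ψ x) : SignType) : ℝ)| = 1 := by
          rcases lt_or_gt_of_ne hψ0 with h | h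
          · rw [sign_neg h]
            simp
          · rw [sign_pos h]
            simp
        rw [map_smul_eq_mul, Real.norm_eq_abs, abs_mul, hs, one_mul,
          abs_of_nonneg (inv_nonneg.2 hqx.le)]
        exact inv_mul_cancel₀ hqx.ne'
      · rw [map_smul, smul_eq_mul, mul_right_comm, sign_mul_self, ← div_eq_mul_inv,
          le_div_iff₀ hqx]
        exact hx.le
    obtain ⟨u, hu1, -, hu⟩ := exists_successive_seq (fun x : ℕ+ →₀ ℝ => x.support)
      (P := fun x => q x = 1 ∧ ε ≤ ψ x) (R := fun _ _ => True)
      (by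
        obtain ⟨x, hx, -⟩ := hcon' 1
        exact ⟨x, hx⟩)
      (fun x hx => Finsupp.support_nonempty_iff.2 (NormingSet.ne_zero_of_norm_eq_one _ hx.1))
      (fun _ _ N => hcon' N)
    obtain ⟨k, hk⟩ := exists_nat_gt (6 * ‖φ‖ / ε)
    set j := k.succPNat
    have hmj : (0 : ℝ) < m j := by exact_mod_cast hm j
    have hkm : (k : ℝ) ≤ m j := by
      have := pnat_le_of_strictMono hml.strictMono_m (hm 1) j
      rw [Nat.succPNat_coe] at this
      exact_mod_cast (by omega : k ≤ m j)
    obtain ⟨c, hc, hc0, hc1, hrap⟩ := exists_isRapid hml hn hu (fun t => (hu1 t).1) j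
    obtain ⟨b, hb, hb1, -, hbnorm⟩ := exists_average_norm_lt hm hml.two_le_m hml.strictMono_m
      (IsSuccessive.linearCombination hu hc) hc1 hrap
    have hv : ∀ t, ε ≤ ψ (Finsupp.linearCombination ℝ u (c t)) := fun t => by
      refine le_trans ?_ (mul_coeffSum_le (fun s => (hu1 s).2) (hc0 t))
      have h1 := norm_linearCombination_le q (fun s => (hu1 s).1.le) (hc0 t)
      rw [hc1] at h1
      exact le_mul_of_one_le_right hε.le h1
    have h1 := mul_coeffSum_le hv hb
    rw [hb1, mul_one, hψ] at h1
    have h2 := h1.trans ((le_abs_self _).trans (φ.le_opNorm _))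
    rw [norm_toSpace] at h2
    have h3 : ‖φ‖ * q (Finsupp.linearCombination ℝ
        (fun t => Finsupp.linearCombination ℝ u (c t)) b) ≤ ‖φ‖ * (6 / m j) :=
      mul_le_mul_of_nonneg_left hbnorm.le (norm_nonneg φ)
    have h4 : ‖φ‖ * (6 / m j) < ε := by
      rw [mul_div_assoc', div_lt_iff₀ hmj]
      rw [div_lt_iff₀ hε] at hk
      nlinarith
    linarith
  rw [Metric.tendsto_atTop]
  intro ε hε
  obtain ⟨N, hN⟩ := key (ε / 2) (half_pos hε)
  refine ⟨N, fun k hk => ?_⟩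
  rw [Real.dist_eq, sub_zero, abs_of_nonneg (ContinuousLinearMap.opNorm_nonneg _)]
  have h := norm_comp_subtypeL_le (normingSet n hm) (φ := φ) (half_pos hε).le (k := k)
    fun x hx => hN x fun p hp => hk.trans (hx p hp)
  linarith

end

section

variable {m l n : ℕ+ → ℕ}

/-! ### Almost block sequences in subspaces -/

/-- The gliding hump: an infinite-dimensional subspace contains vectors arbitrarily close to
unit vectors of `c_00` whose supports lie arbitrarily far to the right. -/
theorem exists_mem_near_tail (𝓜 : NormingSet) {Y : Submodule ℝ 𝓜.Space}
    (hY : ¬ FiniteDimensional ℝ Y) (N : ℕ+) {η : ℝ} (hη : 0 < η) :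
    ∃ x : ℕ+ →₀ ℝ, (∀ p ∈ x.support, N ≤ p) ∧ 𝓜.norm x = 1 ∧
      ∃ y ∈ Y, ‖y - toSpace 𝓜.norm x‖ ≤ η := by
  have hker : ∃ z ∈ Y, z ≠ 0 ∧ ∀ i ≤ N, 𝓜.coord i z = 0 := by
    by_contra! hcon
    let T : Y →ₗ[ℝ] (Finset.Iic N → ℝ) := LinearMap.pi fun i =>
      (𝓜.coord i).toLinearMap ∘ₗ Y.subtype
    refine hY (FiniteDimensional.of_injective T ((injective_iff_map_eq_zero T).2 fun z hz => ?_))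
    by_contra hz0
    obtain ⟨i, hi, hne⟩ := hcon z z.2 fun h => hz0 (Subtype.ext h)
    exact hne (congrFun hz ⟨i, Finset.mem_Iic.2 hi⟩)
  obtain ⟨z, hzY, hz0, hz⟩ := hker
  have hzn : 0 < ‖z‖ := norm_pos_iff.2 hz0
  have hθ : 0 < ‖z‖ * min (1 / 4) (η / 4) := by positivity
  obtain ⟨x, hx⟩ := (denseRange_toSpace 𝓜.norm).exists_dist_lt z hθ
  set w := x - x.filter (fun i => i ≤ N) with hw
  have hwz : ‖z - toSpace 𝓜.norm w‖ ≤ 2 * (‖z‖ * min (1 / 4) (η / 4)) := by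
    have h1 : 𝓜.initialProj N z = 0 := by
      rw [NormingSet.initialProj_apply]
      exact Finset.sum_eq_zero fun i hi => by rw [hz i (Finset.mem_Iic.1 hi), zero_smul]
    have h2 : z - toSpace 𝓜.norm w =
        (z - toSpace 𝓜.norm x) - 𝓜.initialProj N (z - toSpace 𝓜.norm x) := by
      rw [map_sub (𝓜.initialProj N), h1, NormingSet.initialProj_toSpace, hw, map_sub]
      abel
    rw [h2]
    refine (norm_sub_le _ _).trans ?_
    have h3 := 𝓜.norm_initialProj_le N (z - toSpace 𝓜.norm x)
    rw [dist_eq_norm] at hx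
    linarith
  have hθ1 : ‖z‖ * min (1 / 4) (η / 4) ≤ ‖z‖ * (1 / 4) := by
    gcongr
    exact min_le_left _ _
  have hθ2 : ‖z‖ * min (1 / 4) (η / 4) ≤ ‖z‖ * (η / 4) := by
    gcongr
    exact min_le_right _ _
  have hwn : ‖z‖ / 2 ≤ 𝓜.norm w := by
    rw [← norm_toSpace]
    have := norm_sub_norm_le z (toSpace 𝓜.norm w)
    linarith
  have hwpos : 0 < 𝓜.norm w := by linarith
  refine ⟨(𝓜.norm w)⁻¹ • w, ?_, ?_, (𝓜.norm w)⁻¹ • z, Y.smul_mem _ hzY, ?_⟩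
  · intro p hp
    have hpw := Finsupp.support_smul hp
    by_contra hlt
    rw [Finsupp.mem_support_iff, hw, Finsupp.sub_apply,
      Finsupp.filter_apply_pos (fun i => i ≤ N) _ (not_le.1 hlt).le, sub_self] at hpw
    exact hpw rfl
  · rw [map_smul_eq_mul, Real.norm_of_nonneg (inv_nonneg.2 hwpos.le)]
    exact inv_mul_cancel₀ hwpos.ne'
  · rw [map_smul, ← smul_sub, norm_smul, Real.norm_of_nonneg (inv_nonneg.2 hwpos.le),
      inv_mul_le_iff₀ hwpos]
    nlinarith

theorem sum_half_pow_le (F : Finset ℕ+) : ∑ i ∈ F, (1 / 2 : ℝ) ^ (i : ℕ) ≤ 2 := by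
  have h := summable_geometric_two.sum_le_tsum (F.image fun i : ℕ+ => (i : ℕ))
    fun k _ => by positivity
  rwa [tsum_geometric_two, Finset.sum_image fun i _ j _ h => PNat.coe_injective h] at h

/-- An infinite-dimensional subspace contains a small perturbation of a normalized block sequence;
the blocks are then perturbed by little as well. -/
theorem exists_block_sequence_near (hm : ∀ j, 1 ≤ m j)
    {Y : Submodule ℝ (normingSet n hm).Space} (hY : ¬ FiniteDimensional ℝ Y) {δ : ℝ}
    (hδ : 0 < δ) :
    ∃ u : ℕ+ → ℕ+ →₀ ℝ, IsSuccessive u ∧ (∀ t, tsirelsonNorm n hm (u t) = 1) ∧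
      ∀ c : ℕ+ →₀ ℝ, ∃ y ∈ Y, ‖y - toSpace (tsirelsonNorm n hm) (Finsupp.linearCombination ℝ u c)‖ ≤
        δ * tsirelsonNorm n hm (Finsupp.linearCombination ℝ u c) := by
  set q := tsirelsonNorm n hm
  obtain ⟨s, hP, hR, hsucc⟩ := exists_successive_seq
    (fun a : ℝ × (ℕ+ →₀ ℝ) × (normingSet n hm).Space => a.2.1.support)
    (P := fun a => 0 < a.1 ∧ a.1 ≤ δ / 4 ∧ q a.2.1 = 1 ∧ a.2.2 ∈ Y ∧
      ‖a.2.2 - toSpace q a.2.1‖ ≤ a.1)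
    (R := fun a b => b.1 = a.1 / 2)
    (by
      obtain ⟨x, -, hx, y, hy, hxy⟩ := exists_mem_near_tail (normingSet n hm) hY 1
        (η := δ / 4) (by positivity)
      exact ⟨(δ / 4, x, y), by positivity, le_rfl, hx, hy, hxy⟩)
    (fun a ha => Finsupp.support_nonempty_iff.2 (NormingSet.ne_zero_of_norm_eq_one _ ha.2.2.1))
    (by
      rintro ⟨η, x, y⟩ ⟨hη, hηδ, -⟩ N
      dsimp only at hη hηδ
      obtain ⟨x, hN, hx, y, hy, hxy⟩ := exists_mem_near_tail (normingSet n hm) hY N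
        (η := η / 2) (by positivity)
      exact ⟨(η / 2, x, y), ⟨by positivity, by dsimp only; linarith, hx, hy, hxy⟩, rfl, hN⟩)
  have hs : ∀ t : ℕ+, (s t).1 ≤ δ / 2 * (1 / 2) ^ (t : ℕ) := by
    intro t
    induction t using PNat.recOn with
    | one =>
      have := (hP 1).2.1
      rw [PNat.one_coe]
      linarith
    | succ t ih =>
      rw [hR t, PNat.add_coe, PNat.one_coe, pow_succ]
      linarith
  have hu : IsSuccessive fun t => (s t).2.1 := hsucc
  refine ⟨fun t => (s t).2.1, hu, fun t => (hP t).2.2.1, fun c => ?_⟩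
  refine ⟨∑ t ∈ c.support, c t • (s t).2.2, Y.sum_mem fun t _ => Y.smul_mem _ (hP t).2.2.2.1, ?_⟩
  rw [toSpace_linearCombination, ← Finset.sum_sub_distrib]
  set r := q (Finsupp.linearCombination ℝ (fun t => (s t).2.1) c) with hr
  have hr0 : 0 ≤ r := apply_nonneg q _
  have hc : ∀ t, |c t| ≤ r := fun t => by
    have h := hu.abs_mul_norm_le hm (n := n) c t
    rwa [(hP t).2.2.1, mul_one] at h
  calc ‖∑ t ∈ c.support, (c t • (s t).2.2 - c t • toSpace q (s t).2.1)‖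
      ≤ ∑ t ∈ c.support, r * (δ / 2 * (1 / 2) ^ (t : ℕ)) := by
        refine (norm_sum_le _ _).trans (Finset.sum_le_sum fun t _ => ?_)
        rw [← smul_sub, norm_smul, Real.norm_eq_abs]
        exact mul_le_mul (hc t) ((hP t).2.2.2.2.trans (hs t)) (norm_nonneg _) hr0
    _ = r * (δ / 2) * ∑ t ∈ c.support, (1 / 2 : ℝ) ^ (t : ℕ) := by
        rw [Finset.mul_sum]
        exact Finset.sum_congr rfl fun t _ => by ring
    _ ≤ r * (δ / 2) * 2 := by
        gcongr
        exact sum_half_pow_le _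
    _ = δ * r := by ring

/-! ### Distortion -/

/-- The `j`-th layer norm, extended to the completion under the original norm. -/
def layerSeminorm (n : ℕ+ → ℕ) (hm : ∀ j, 1 ≤ m j) (j : ℕ+) :
    Seminorm ℝ (normingSet n hm).Space :=
  (normSeminorm ℝ (layerSet n hm j).Space).comp
    ((toSpace (layerNorm n hm j)).extendOfNorm (toSpace (tsirelsonNorm n hm))).toLinearMap

section LayerSeminorm

variable (hm : ∀ j, 1 ≤ m j) (j : ℕ+)

theorem norm_toSpace_layerNorm_le (x : ℕ+ →₀ ℝ) : ‖toSpace (layerNorm n hm j) x‖ ≤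
    m j * ‖toSpace (tsirelsonNorm n hm) x‖ := by
  rw [norm_toSpace, norm_toSpace]
  exact layerNorm_le hm j x

theorem layerSeminorm_toSpace (x : ℕ+ →₀ ℝ) :
    layerSeminorm n hm j (toSpace (tsirelsonNorm n hm) x) = layerNorm n hm j x := by
  rw [← norm_toSpace]
  exact congrArg norm (LinearMap.extendOfNorm_eq (denseRange_toSpace _)
    ⟨_, norm_toSpace_layerNorm_le hm j⟩ x)

theorem layerSeminorm_le (z : (normingSet n hm).Space) :
    layerSeminorm n hm j z ≤ m j * ‖z‖ :=
  LinearMap.norm_extendOfNorm_apply_le (denseRange_toSpace _) _ (norm_toSpace_layerNorm_le hm j) z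

theorem norm_le_layerSeminorm (z : (normingSet n hm).Space) : ‖z‖ ≤ layerSeminorm n hm j z := by
  have hcont : Continuous fun z => layerSeminorm n hm j z :=
    continuous_norm.comp ((toSpace (layerNorm n hm j)).extendOfNorm
      (toSpace (tsirelsonNorm n hm))).continuous
  refine (denseRange_toSpace (tsirelsonNorm n hm)).induction_on z
    (isClosed_le continuous_norm hcont) fun x => ?_
  rw [layerSeminorm_toSpace, norm_toSpace]
  exact tsirelsonNorm_le_layerNorm hm j x

end LayerSeminorm

/-- The layer norms distort: in every infinite-dimensional subspace, an average of a rapidly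
increasing sequence has `j`-th layer norm at least `1` but norm less than `6/m_j`, while a vector
that is small against all functionals of weight `m_j` has norm one and `j`-th layer norm at
most `3`. -/
theorem arbitrarilyDistortable_normingSet (hml : IsParameterPair m l) (hn : IsGood m l n)
    (hm : ∀ j, 1 ≤ m j) (hfn : ∀ j, fSeq m n j + 1 ≤ n j) :
    ArbitrarilyDistortable (normingSet n hm).Space := by
  intro lam hlam
  obtain ⟨k, hk⟩ := exists_nat_gt (112 * lam)
  set j := k.succPNat
  have hmj : (0 : ℝ) < m j := by exact_mod_cast hm j
  have hkm : (k : ℝ) ≤ m j := by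
    have := pnat_le_of_strictMono hml.strictMono_m (hm 1) j
    rw [Nat.succPNat_coe] at this
    exact_mod_cast (by omega : k ≤ m j)
  refine ⟨layerSeminorm n hm j, ⟨1, m j, one_pos, hmj, fun z =>
    ⟨by rw [one_mul]; exact norm_le_layerSeminorm hm j z, layerSeminorm_le hm j z⟩⟩, ?_⟩
  intro Y _ hY
  have hδ : (0 : ℝ) < 1 / (12 * m j) := by positivity
  have hδ' : (1 : ℝ) / (12 * m j) ≤ 1 / 12 := by
    have : (1 : ℝ) ≤ m j := by exact_mod_cast hm j
    exact div_le_div_of_nonneg_left zero_le_one (by norm_num) (by linarith)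
  obtain ⟨u, hu, hu1, hnear⟩ := exists_block_sequence_near hm hY hδ
  set q := tsirelsonNorm n hm
  -- The perturbation changes the layer norm by at most a twelfth of the norm.
  have hpert : ∀ (x : ℕ+ →₀ ℝ) (y : (normingSet n hm).Space),
      ‖y - toSpace q x‖ ≤ 1 / (12 * m j) * q x →
      |layerSeminorm n hm j y - layerNorm n hm j x| ≤ 1 / 12 * q x ∧
        |‖y‖ - q x| ≤ 1 / 12 * q x := by
    intro x y h
    constructor
    · rw [← layerSeminorm_toSpace]
      refine (abs_sub_map_le_sub (layerSeminorm n hm j) y _).trans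
        ((layerSeminorm_le hm j _).trans ?_)
      calc (m j : ℝ) * ‖y - toSpace q x‖ ≤ m j * (1 / (12 * m j) * q x) := by gcongr
        _ = 1 / 12 * q x := by field_simp
    · rw [← norm_toSpace]
      refine (abs_norm_sub_norm_le y _).trans (h.trans ?_)
      rw [norm_toSpace]
      exact mul_le_mul_of_nonneg_right hδ' (apply_nonneg q x)
  obtain ⟨c, hc, hc0, hc1, hrap⟩ := exists_isRapid hml hn hu hu1 j
  have hv := hu.linearCombination hc
  obtain ⟨b, hb, hb1, hbS, hbnorm⟩ := exists_average_norm_lt hm hml.two_le_m hml.strictMono_m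
    hv hc1 hrap
  have hblayer := hv.sum_abs_le_layerNorm hm hc1 (j := j) (schreier_mono (hfn j) hbS)
  rw [Finset.sum_congr rfl fun i _ => abs_of_nonneg (hb i), ← coeffSum_apply, hb1] at hblayer
  rw [linearCombination_linearCombination] at hbnorm hblayer
  obtain ⟨c', -, -, hc'1, hc'⟩ := exists_block_of_small_weights hml hn hu hu1 (j + 1) 1
  have hc'layer : layerNorm n hm j (Finsupp.linearCombination ℝ u c') ≤ 3 := by
    refine NormingSet.norm_le _ fun f hf => ?_
    have h := (le_abs_self _).trans (hc' j (PNat.lt_add_right j 1) f hf)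
    rw [pairing_smul_right, ← div_eq_inv_mul] at h
    exact (div_le_div_iff_of_pos_right hmj).1 h
  obtain ⟨x, hxY, hx⟩ := hnear (Finsupp.linearCombination ℝ c b)
  obtain ⟨y, hyY, hy⟩ := hnear c'
  obtain ⟨hx1, hx2⟩ := hpert _ _ hx
  obtain ⟨hy1, hy2⟩ := hpert _ _ hy
  rw [abs_le] at hx1 hx2 hy1 hy2
  have hc'q : q (Finsupp.linearCombination ℝ u c') = 1 := hc'1
  rw [hc'q] at hy1 hy2
  have hm7 : (7 : ℝ) ≤ m j := by exact_mod_cast hml.seven_le j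
  have hb6 : (6 : ℝ) / m j ≤ 1 := by
    rw [div_le_one hmj]
    linarith
  set A := Finsupp.linearCombination ℝ u (Finsupp.linearCombination ℝ c b)
  have hqA : q A < 6 / m j := hbnorm
  have hpx : 1 / 2 ≤ layerSeminorm n hm j x := by linarith [hx1.1]
  have hnx : ‖x‖ ≤ 7 / m j := by
    have h7 : (7 : ℝ) / m j = 13 / 12 * (6 / m j) + 1 / 2 / m j := by ring
    have : (0 : ℝ) < 1 / 2 / m j := by positivity
    linarith [hx2.2]
  have hpy : layerSeminorm n hm j y ≤ 4 := by linarith [hy1.2]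
  have hny : 1 / 2 ≤ ‖y‖ := by linarith [hy2.1]
  have hx0 : 0 < ‖x‖ := by
    have := layerSeminorm_le hm j x
    by_contra h
    have h0 : ‖x‖ = 0 := le_antisymm (not_lt.1 h) (norm_nonneg x)
    rw [h0, mul_zero] at this
    linarith
  have hy0 : 0 < ‖y‖ := by linarith
  have hpy0 : 0 < layerSeminorm n hm j y := hy0.trans_le (norm_le_layerSeminorm hm j y)
  refine ⟨‖y‖ • x, Y.smul_mem _ hxY, ‖x‖ • y, Y.smul_mem _ hyY,
    smul_ne_zero hy0.ne' (norm_pos_iff.1 hx0), smul_ne_zero hx0.ne' (norm_pos_iff.1 hy0), ?_, ?_⟩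
  · rw [norm_smul, norm_smul, norm_norm, norm_norm, mul_comm]
  · rw [map_smul_eq_mul, map_smul_eq_mul, norm_norm, norm_norm, lt_div_iff₀ (by positivity)]
    have h1 : lam * (‖x‖ * layerSeminorm n hm j y) ≤ lam * (7 / m j * 4) := by gcongr
    have h2 : lam * (7 / m j * 4) < 1 / 4 := by
      have : lam * (7 / m j * 4) = 28 * lam / m j := by ring
      rw [this, div_lt_iff₀ hmj]
      linarith
    have h3 : (1 : ℝ) / 4 ≤ ‖y‖ * layerSeminorm n hm j x := by nlinarith
    linarith

/-! ### The distortion property -/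

theorem IsGood.five_mul_lt (hml : IsParameterPair m l) (hn : IsGood m l n) (j : ℕ+) :
    5 * (fSeq m n j + 1) < n j := by
  have h1 : 5 ≤ l j := hml.four_lt.trans_le (hml.strictMono_l.monotone one_le)
  exact (Nat.mul_le_mul_right _ h1).trans_lt (hn.lt j)

theorem hasDistortionProperty_normingSet (hml : IsParameterPair m l) (hn : IsGood m l n)
    (hm : ∀ j, 1 ≤ m j) :
    HasDistortionProperty (normingSet n hm).e 6 n (fun i => fSeq m n i + 2)
      (fun i => 1 / (m i : ℝ)) := by
  have hlt := IsGood.five_mul_lt hml hn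
  have hle : ∀ r j, r < j → n r ≤ fSeq m n j := fun r j h =>
    le_fSeq hml.two_le_m hml.strictMono_m h
  have hmpos : ∀ j, (0 : ℝ) < m j := fun j => by exact_mod_cast hm j
  refine ⟨NormingSet.isSchauderBasis _, by norm_num, hn.strictMono_n, fun i => ?_, fun i j h => ?_,
    fun i => by positivity, fun i => ?_, fun i => ?_, fun i j h => ?_, ?_, fun j => ?_,
    fun j u hu => ?_⟩
  · have := hlt i
    omega
  · have := hle i j h
    have := hlt i
    omega
  · have := hle i (i + 1) (PNat.lt_add_right i 1)
    omega
  · have h : 2 * (fSeq m n i + 2) < n i := by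
      have := hlt i
      omega
    rw [lt_div_iff₀ two_pos, mul_comm]
    exact_mod_cast h
  · exact one_div_lt_one_div_of_lt (hmpos i) (by exact_mod_cast hml.strictMono_m h)
  · rw [Metric.tendsto_atTop]
    intro ε hε
    obtain ⟨k, hk⟩ := exists_nat_gt (1 / ε)
    refine ⟨k.succPNat, fun i hi => ?_⟩
    have h1 : k + 1 ≤ (i : ℕ) := by
      rw [← Nat.succ_eq_add_one, ← Nat.succPNat_coe]
      exact hi
    have h2 := pnat_le_of_strictMono hml.strictMono_m (hm 1) i
    have h3 : (k : ℝ) ≤ m i := by exact_mod_cast (by omega : k ≤ m i)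
    rw [Real.dist_eq, sub_zero, abs_of_pos (one_div_pos.2 (hmpos i))]
    exact (one_div_lt hε (hmpos i)).1 (hk.trans_le h3)
  · exact isAsymptoticL1_normingSet hm (by have := hlt j; omega)
  · refine (tau_le_fSeq hml hn hm j hu).trans_lt ?_
    exact_mod_cast (by omega : fSeq m n j < fSeq m n j + 2)

end

end

theorem theorem4p1 (m l n : ℕ+ → ℕ) (hml : IsParameterPair m l) (hn : IsGood m l n) :
    (∃! q : Seminorm ℝ (ℕ+ →₀ ℝ), IsMixedTsirelsonNorm m n q) ∧
    ∃ 𝓜 : NormingSet,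
      (∃ Φ : 𝓜.Space ≃ₗᵢ[ℝ] MixedTsirelson m n,
        ∀ i, Φ (𝓜.e i) = unitVec (mixedTsirelsonNorm m n) i) ∧
      IsSchauderBasis 𝓜.e ∧ IsOneUnconditional 𝓜.e ∧ IsShrinking 𝓜.e ∧ IsBimonotone 𝓜.e ∧
      HasDistortionProperty 𝓜.e 6 n (fun i => fSeq m n i + 2) (fun i => 1 / (m i : ℝ)) ∧
      ArbitrarilyDistortable 𝓜.Space := by
  have hm := hml.one_le_m
  have hq := isMixedTsirelsonNorm_tsirelsonNorm (n := n) hm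
  refine ⟨⟨_, hq, fun q' hq' => hq'.unique hml.two_le_m hq⟩, normingSet n hm,
    exists_isometry_of_eq (mixedTsirelsonNorm_eq hm hml.two_le_m).symm,
    NormingSet.isSchauderBasis _, isOneUnconditional_normingSet hm,
    isShrinking_normingSet hml hn hm, isBimonotone_normingSet hm,
    hasDistortionProperty_normingSet hml hn hm,
    arbitrarilyDistortable_normingSet hml hn hm fun j => ?_⟩
  have := IsGood.five_mul_lt hml hn j
  omega
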